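/- Consider a $K$-tier network ($K\ge 1$) in the plane $\mathbb{R}^2$ with path loss exponent $\alpha>2$. For $t\in\{1,\dots,K\}$ the base stations (BSs) of tier $t$ form a homogeneous Poisson point process (PPP) $\Phi_t$ of density $\lambda_t>0$ and have transmit power $P_t>0$; the interfering scheduled users of tier $t$ are modelled as a homogeneous PPP of density $\lambda_t$ with transmit power $P_U>0$; the jammers form a homogeneous PPP of density $\lambda_J>0$ with transmit power $P_J>0$. All these processes are independent, and all channel gains are independent exponential random variables of mean $1$, independent of the locations. The typical user, at the origin, is served by the nearest BS of the tier $k$ that maximizes $P_tD_t^{-\alpha}$, where $D_t$ is the distance from the origin to the nearest BS of tier $t$. Its SINR is the power $P_k h D^{-\alpha}$ received from the serving BS (at distance $D$, with channel gain $h$) divided by the sum of the powers received from all other BSs, all interfering users and all active jammers, of the residual self-interference $N_S$, and of the thermal noise $N_0$. Assume that $N_S=N_0=0$ and that there is no jammer selection ($\tau=\infty$, all jammers are active). Put $\Xi=\sum_{t}\lambda_tP_t^{2/\alpha}$ and $\operatorname{sinc}(x)=\frac{\sin(\pi x)}{\pi x}$, and let ${}_2F_1$ be the Gauss hypergeometric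 function (analytically continued to $(-\infty,1)$). Then for every threshold $\theta_c>0$ the connection probability $\tilde{\mathcal P}_c(\theta_c)=\mathbb{P}(\mathrm{SINR}\ge\theta_c)$ is $$ \tilde{\mathcal P}_c(\theta_c)=\pi\,\Xi\int_0^\infty \exp\Big(-\tfrac{2\pi v\,\theta_c\,\Xi}{\alpha-2}\,{}_2F_1\big(1,1-\tfrac2\alpha;2-\tfrac2\alpha;-\theta_c\big)\Big) \exp\Big(-\tfrac{\pi v(\theta_cP_U)^{2/\alpha}\sum_{t}\lambda_t}{\operatorname{sinc}(2/\alpha)}\Big) \exp\Big(-\tfrac{\pi v(\theta_cP_J)^{2/\alpha}\lambda_J}{\operatorname{sinc}(2/\alpha)}\Big) \exp(-\pi v\,\Xi)\,dv . $$ Moreover, for every tier $k$, the conditional connection probability $\mathbb{P}(\mathrm{SINR}\ge\theta_c\mid\text{the serving BS belongs to tier }k)$ equals this same expression; in particular it does not depend on $k$. -/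

import Mathlib

open MeasureTheory ProbabilityTheory
open scoped ENNReal NNReal

noncomputable section

/-- The Euclidean plane, in which all nodes are located. -/
abbrev Plane : Type := EuclideanSpace ℝ (Fin 2)

/-- The Gauss hypergeometric function `₂F₁(a, b; c; z)` for real `0 < b < c` and every real
`z < 1`, given by Euler's integral. On `|z| < 1` this is the sum of the hypergeometric series;
Mathlib's `₂F₁` is that sum and takes a junk value outside the disc of convergence, whereas here
arguments `z ≤ -1` are needed as well. -/
def gaussHypergeometric (a b c z : ℝ) : ℝ :=
  Real.Gamma c / (Real.Gamma b * Real.Gamma (c - b)) *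
    ∫ t in (0 : ℝ)..1, t ^ (b - 1) * (1 - t) ^ (c - b - 1) * (1 - z * t) ^ (-a)

/-! ### Poisson point configurations -/

/-- The random counting measure `∑ᵢ δ_{xᵢ}` of a randomly enumerated configuration of points. -/
def countingMeasure {Ω : Type*} (x : ℕ → Ω → Plane) (ω : Ω) : Measure Plane :=
  Measure.sum fun i => Measure.dirac (x i ω)

/-- The random points `x 0, x 1, …` form a homogeneous Poisson point process (PPP) of density
`lam` in the plane: the number of points in a Borel set of finite area `A` is Poisson distributed
with mean `lam * A`, and the numbers of points in pairwise disjoint Borel sets are independent. -/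
structure IsHomogeneousPPP {Ω : Type*} [MeasurableSpace Ω] (x : ℕ → Ω → Plane) (lam : ℝ)
    (μ : Measure Ω) : Prop where
  measurable : ∀ i, Measurable (x i)
  poisson_count : ∀ A : Set Plane, MeasurableSet A → volume A ≠ ∞ →
    HasLaw (fun ω => countingMeasure x ω A)
      ((poissonMeasure (lam.toNNReal * (volume A).toNNReal)).map (fun n : ℕ => (n : ℝ≥0∞))) μ
  indep_count : ∀ (n : ℕ) (A : Fin n → Set Plane), (∀ i, MeasurableSet (A i)) →
    Pairwise (fun i j => Disjoint (A i) (A j)) →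
    iIndepFun (fun i ω => countingMeasure x ω (A i)) μ

/-! ### The network -/

/-- The deterministic parameters of a `K`-tier network: for each tier the density and the
transmit power of its base stations, the density and the transmit power of the jammers, the
transmit power of the users, and the path loss exponent. -/
structure HetNet (K : ℕ) where
  lam : Fin K → ℝ
  P : Fin K → ℝ
  lamJ : ℝ
  PJ : ℝ
  PU : ℝ
  α : ℝ
  lam_pos : ∀ t, 0 < lam t
  P_pos : ∀ t, 0 < P t
  lamJ_pos : 0 < lamJ
  PJ_pos : 0 < PJ
  PU_pos : 0 < PU
  two_lt_α : 2 < α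

/-- The classes of nodes: base stations of tier `t`, interfering users (scheduled users other
than the typical user) of tier `t`, and jammers. -/
inductive NodeClass (K : ℕ) : Type
  | bs (t : Fin K)
  | user (t : Fin K)
  | jammer

namespace HetNet

variable {K : ℕ} (N : HetNet K)

/-- Density of each class of nodes. One user is scheduled per base station, so that in the
homogeneous model the interfering users of tier `t` have the density of the base stations of
tier `t`. -/
def density : NodeClass K → ℝ
  | .bs t => N.lam t
  | .user t => N.lam t
  | .jammer => N.lamJ

/-- Transmit power of each class of nodes. -/
def power : NodeClass K → ℝ
  | .bs t => N.P t
  | .user _ => N.PU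
  | .jammer => N.PJ

/-- `Ξ = ∑ₜ λₜ Pₜ ^ (2 / α)`. -/
def Xi : ℝ := ∑ t, N.lam t * N.P t ^ (2 / N.α)

/-- The path loss `d ↦ d ^ (-α)` (infinite at `d = 0`). -/
def pathLoss (d : ℝ) : ℝ≥0∞ := ENNReal.ofReal d ^ (-N.α)

variable {Ω : Type*}

/-- Node locations `X` and channel gains `h` (towards the typical user, which is located at the
origin) realize the network on `(Ω, μ)`: base stations of each tier, interfering users of each
tier and jammers are independent homogeneous PPPs; the channel gains are independent,
exponentially distributed with mean one (Rayleigh fading), and independent of the locations. -/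
structure IsRealization [MeasurableSpace Ω] (X : NodeClass K → ℕ → Ω → Plane)
    (h : NodeClass K → ℕ → Ω → ℝ) (μ : Measure Ω) : Prop where
  ppp : ∀ c, IsHomogeneousPPP (X c) (N.density c) μ
  indep_classes : iIndepFun (fun (c : NodeClass K) ω (i : ℕ) => X c i ω) μ
  fading_measurable : ∀ c i, Measurable (h c i)
  fading_law : ∀ c i, μ.map (h c i) = expMeasure 1
  fading_indep : iIndepFun (fun (p : NodeClass K × ℕ) ω => h p.1 p.2 ω) μ
  fading_indep_locations :
    IndepFun (fun ω (p : NodeClass K × ℕ) => X p.1 p.2 ω)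
      (fun ω (p : NodeClass K × ℕ) => h p.1 p.2 ω) μ

variable (X : NodeClass K → ℕ → Ω → Plane) (h : NodeClass K → ℕ → Ω → ℝ)

/-- The distance `D_t` from the typical user to the nearest base station of tier `t`. -/
def nearestDist (t : Fin K) (ω : Ω) : ℝ := ⨅ i, ‖X (.bs t) i ω‖

/-- Association rule: `(k, i)` is a serving base station if tier `k` maximizes `P_t D_t ^ (-α)`
over all tiers `t`, and the `i`-th base station of tier `k` is the nearest one in that tier. -/
def IsServing (ω : Ω) (b : Fin K × ℕ) : Prop :=
  (∀ t, ENNReal.ofReal (N.P t) * N.pathLoss (nearestDist X t ω) ≤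
      ENNReal.ofReal (N.P b.1) * N.pathLoss (nearestDist X b.1 ω)) ∧
    ‖X (.bs b.1) b.2 ω‖ = nearestDist X b.1 ω

/-- The serving base station (almost surely there is exactly one). -/
def servingBS [NeZero K] (ω : Ω) : Fin K × ℕ :=
  Classical.epsilon (N.IsServing X ω)

/-- Power received by the typical user from the `i`-th node of class `c`. -/
def received (c : NodeClass K) (i : ℕ) (ω : Ω) : ℝ≥0∞ :=
  ENNReal.ofReal (N.power c) * ENNReal.ofReal (h c i ω) * N.pathLoss ‖X c i ω‖

open Classical in
/-- Interference from all base stations other than the serving one. -/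
def interferenceBS [NeZero K] (ω : Ω) : ℝ≥0∞ :=
  ∑ t, ∑' i, if (t, i) = N.servingBS X ω then 0 else N.received X h (.bs t) i ω

/-- Interference from the scheduled users other than the typical one. -/
def interferenceUser (ω : Ω) : ℝ≥0∞ :=
  ∑ t, ∑' i, N.received X h (.user t) i ω

/-- Jammer selection with threshold `τ`: the `j`-th jammer is active if `P_J D ^ (-α) < τ` for its
distance `D` to every scheduled user (the typical user at the origin and the others). There is no
jammer selection when `τ = ∞`. -/
def JammerActive (τ : ℝ≥0∞) (ω : Ω) (j : ℕ) : Prop :=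
  ENNReal.ofReal N.PJ * N.pathLoss ‖X .jammer j ω‖ < τ ∧
    ∀ t i, ENNReal.ofReal N.PJ * N.pathLoss (dist (X .jammer j ω) (X (.user t) i ω)) < τ

open Classical in
/-- Interference from the active jammers. -/
def interferenceJammer (τ : ℝ≥0∞) (ω : Ω) : ℝ≥0∞ :=
  ∑' j, if N.JammerActive X τ ω j then N.received X h .jammer j ω else 0

/-- The SINR of the typical user, with jammer selection threshold `τ`, residual self-interference
`NS` and thermal noise `N0`. -/
def sinr [NeZero K] (τ NS N0 : ℝ≥0∞) (ω : Ω) : ℝ≥0∞ :=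
  N.received X h (.bs (N.servingBS X ω).1) (N.servingBS X ω).2 ω /
    (N.interferenceBS X h ω + N.interferenceUser X h ω + N.interferenceJammer X h τ ω + NS + N0)

/-- The event that the typical user is connected: `SINR ≥ θ`. -/
def connected [NeZero K] (τ NS N0 : ℝ≥0∞) (θ : ℝ) : Set Ω :=
  {ω | ENNReal.ofReal θ ≤ N.sinr X h τ NS N0 ω}

/-- The event that the serving base station belongs to tier `k`. -/
def servedBy [NeZero K] (k : Fin K) : Set Ω :=
  {ω | (N.servingBS X ω).1 = k}

end HetNet

end

/-! For each base station of tier `k`, consider the event that it serves and that its signal is at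
least `θ` times the sum of all the others. Given the locations, with the station at distance `r`,
serving means that no tier `t` has a point closer than `(P_t / P_k)^(1/α) r`. Rayleigh fading turns
the SINR condition into a Laplace transform, a product of factors `1 / (1 + θ P |x|^(-α) / (P_k
r^(-α)))` over the other nodes. Both are exponentials of sums over points, so the conditional
probability of the event is a single `exp (-∑ g)`, with `g = ∞` on the forbidden discs
(`nodeExponent`, `expNeg_sum_classExponent`).

The Campbell–Mecke formula (`lintegral_tsum_expNeg`) evaluates the sum over all stations of tier `k`
of the probabilities of these events. It comes from the Laplace functional of a PPP, which is
computed on simple functions and then differentiated in a direction. The exponent is homogeneous of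
degree two in `r`, namely `π r² W(θ) / P_k^(2/α)` with `W = decayRate` independent of `k`
(`sum_density_mul_lintegral`). Integrating over the plane gives `λ_k P_k^(2/α) / W(θ)`.

At `θ = 0` the SINR condition is void and `W(0) = Ξ`, so the expected number of serving stations in
tier `k` is `λ_k P_k^(2/α) / Ξ`. These numbers sum to `1`, and almost surely a serving station
exists, so it is almost surely unique. Hence the sums above are probabilities. Summing over `k`, or
dividing by the probability of tier `k`, gives `Ξ / W(θ)` in both cases, and this is the value of
the integral in the statement.

All expectations are taken in `[0, ∞]`, with `exp (-∞) = 0`, so that infinite interference needs no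
separate treatment. -/

/-! ### Exponential, logarithm and difference quotients on `[0, ∞]`. -/

/-- The function `x ↦ exp (-x)` on `[0, ∞]`. -/
noncomputable def expNeg (x : ℝ≥0∞) : ℝ≥0∞ := EReal.exp (-(x : EReal))

theorem expNeg_eq_inv (x : ℝ≥0∞) : expNeg x = (EReal.exp x)⁻¹ := EReal.exp_neg _

@[simp] theorem expNeg_zero : expNeg 0 = 1 := by simp [expNeg]

@[simp] theorem expNeg_top : expNeg ∞ = 0 := by simp [expNeg]

theorem expNeg_add (x y : ℝ≥0∞) : expNeg (x + y) = expNeg x * expNeg y := by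
  unfold expNeg
  rw [EReal.coe_ennreal_add, EReal.neg_add, sub_eq_add_neg, EReal.exp_add]
  · left; simp
  · right; simp

theorem expNeg_antitone : Antitone expNeg := fun x y hxy => by
  unfold expNeg
  rw [EReal.exp_le_exp_iff, EReal.neg_le_neg_iff]
  exact_mod_cast hxy

theorem expNeg_le_one (x : ℝ≥0∞) : expNeg x ≤ 1 := by
  simpa using expNeg_antitone (zero_le (a := x))

theorem expNeg_ne_top (x : ℝ≥0∞) : expNeg x ≠ ∞ :=
  ne_top_of_le_ne_top ENNReal.one_ne_top (expNeg_le_one x)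

theorem continuous_expNeg : Continuous expNeg :=
  ENNReal.continuous_exp.comp (continuous_neg.comp continuous_coe_ennreal_ereal)

@[fun_prop] theorem measurable_expNeg : Measurable expNeg := continuous_expNeg.measurable

theorem expNeg_ofReal {x : ℝ} (hx : 0 ≤ x) :
    expNeg (ENNReal.ofReal x) = ENNReal.ofReal (Real.exp (-x)) := by
  unfold expNeg
  rw [EReal.coe_ennreal_ofReal, max_eq_left hx, ← EReal.coe_neg, EReal.exp_coe]

theorem expNeg_eq_ofReal {x : ℝ≥0∞} (hx : x ≠ ∞) :
    expNeg x = ENNReal.ofReal (Real.exp (-x.toReal)) := by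
  rw [← expNeg_ofReal ENNReal.toReal_nonneg, ENNReal.ofReal_toReal hx]

theorem expNeg_finsetSum {ι : Type*} (s : Finset ι) (f : ι → ℝ≥0∞) :
    expNeg (∑ i ∈ s, f i) = ∏ i ∈ s, expNeg (f i) := by
  classical
  induction s using Finset.induction_on with
  | empty => simp
  | insert a s ha ih => rw [Finset.sum_insert ha, Finset.prod_insert ha, expNeg_add, ih]

/-- Lets an indicator enter an exponent: the serving condition becomes an infinite penalty on
violations. -/
theorem expNeg_top_mul (x : ℝ≥0∞) : expNeg (∞ * x) = if x = 0 then 1 else 0 := by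
  split_ifs with h
  · simp [h]
  · simp [ENNReal.top_mul h]

/-- The function `z ↦ log (1 + z)` on `[0, ∞]`. -/
noncomputable def logOneAdd (z : ℝ≥0∞) : ℝ≥0∞ := (ENNReal.log (1 + z)).toENNReal

/-- The right side is the Laplace transform of a unit-mean exponential gain, so `logOneAdd` is the
exponent left after averaging over one fading variable. -/
theorem expNeg_logOneAdd (z : ℝ≥0∞) : expNeg (logOneAdd z) = (1 + z)⁻¹ := by
  rw [expNeg_eq_inv, logOneAdd, EReal.coe_toENNReal, ENNReal.exp_log]
  simp

@[simp] theorem logOneAdd_zero : logOneAdd 0 = 0 := by simp [logOneAdd]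

theorem continuous_logOneAdd : Continuous logOneAdd :=
  (ENNReal.continuous_log.comp (continuous_const.add continuous_id)).ereal_toENNReal

@[fun_prop] theorem measurable_logOneAdd : Measurable logOneAdd := continuous_logOneAdd.measurable

theorem monotone_logOneAdd : Monotone logOneAdd := fun x y hxy => by
  unfold logOneAdd
  apply EReal.toENNReal_le_toENNReal
  exact ENNReal.log_monotone (by gcongr)

/-- `expNeg` turns infinite sums into limits of finite products. -/
theorem tendsto_prod_expNeg {ι : Type*} (f : ι → ℝ≥0∞) :
    Filter.Tendsto (fun s : Finset ι => ∏ i ∈ s, expNeg (f i)) Filter.atTop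
      (nhds (expNeg (∑' i, f i))) := by
  have := (continuous_expNeg.tendsto _).comp (ENNReal.summable (f := f)).hasSum
  exact this.congr fun s => expNeg_finsetSum s f

/-- The difference quotients `2 ^ n * (1 - exp (-x / 2 ^ n))`, which increase to `x`. -/
noncomputable def expQuotient (n : ℕ) (x : ℝ≥0∞) : ℝ≥0∞ := 2 ^ n * (1 - expNeg ((2 ^ n)⁻¹ * x))

theorem one_sub_expNeg_le (x : ℝ≥0∞) : 1 - expNeg x ≤ x := by
  by_cases hx : x = ∞
  · simp [hx]
  rw [expNeg_eq_ofReal hx, ← ENNReal.ofReal_one, ← ENNReal.ofReal_sub _ (Real.exp_pos _).le]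
  refine ENNReal.ofReal_le_of_le_toReal ?_
  have := Real.add_one_le_exp (-x.toReal)
  linarith

theorem expQuotient_le (n : ℕ) (x : ℝ≥0∞) : expQuotient n x ≤ x := by
  unfold expQuotient
  calc _ ≤ 2 ^ n * ((2 ^ n)⁻¹ * x) := by gcongr; exact one_sub_expNeg_le _
    _ = x := by
      rw [← mul_assoc, ENNReal.mul_inv_cancel (by simp) (by simp), one_mul]

/-- Dyadic steps make consecutive quotients comparable: with `e` the exponential at the finer step,
the coarser one is `e * e`, and `1 - e² ≤ 2 (1 - e)`. -/
theorem expQuotient_mono_left (x : ℝ≥0∞) : Monotone (fun n => expQuotient n x) := by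
  refine monotone_nat_of_le_succ fun n => ?_
  unfold expQuotient
  set e := expNeg ((2 ^ (n + 1))⁻¹ * x) with he
  have h1 : expNeg ((2 ^ n)⁻¹ * x) = e * e := by
    rw [he, ← expNeg_add]
    congr 1
    rw [pow_succ, ENNReal.mul_inv (by simp) (by simp), ← add_mul, ← mul_add,
      ENNReal.inv_two_add_inv_two, mul_one]
  have h2 : 1 - e * e ≤ 2 * (1 - e) := by
    have he1 : e ≤ 1 := expNeg_le_one _
    rw [tsub_le_iff_right]
    calc (1 : ℝ≥0∞) = (1 - e) + e := (tsub_add_cancel_of_le he1).symm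
      _ = (1 - e) + ((1 - e) + e) * e := by
        rw [tsub_add_cancel_of_le he1, one_mul, tsub_add_cancel_of_le he1]
      _ = (1 - e) + (1 - e) * e + e * e := by ring
      _ ≤ (1 - e) + (1 - e) * 1 + e * e := by gcongr
      _ = _ := by ring
  rw [h1, pow_succ, mul_assoc]
  gcongr

theorem expQuotient_mono_right (n : ℕ) : Monotone (expQuotient n) := fun x y h => by
  unfold expQuotient
  gcongr
  exact expNeg_antitone (by gcongr)

theorem tendsto_expQuotient (x : ℝ≥0∞) :
    Filter.Tendsto (fun n => expQuotient n x) Filter.atTop (nhds x) := by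
  by_cases hx : x = ∞
  · subst hx
    have h : (fun n => expQuotient n ∞) = fun n => (2 : ℝ≥0∞) ^ n := by
      funext n
      simp [expQuotient, ENNReal.mul_top]
    rw [h]
    simp
  · have key : Filter.Tendsto (fun n : ℕ => ENNReal.ofReal
        ((2 : ℝ) ^ n * (1 - Real.exp (-(x.toReal / 2 ^ n))))) Filter.atTop
        (nhds (ENNReal.ofReal x.toReal)) := by
      refine ENNReal.tendsto_ofReal ?_
      -- The quotients are the slopes of this function between `0` and `s = 2⁻ⁿ`.
      have hd : HasDerivAt (fun s : ℝ => 1 - Real.exp (-(x.toReal * s))) x.toReal 0 := by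
        have := (((hasDerivAt_id (0 : ℝ)).const_mul x.toReal).neg.exp).const_sub 1
        simpa using this
      have hs : Filter.Tendsto (fun n : ℕ => ((1 / 2 : ℝ) ^ n)) Filter.atTop
          (nhdsWithin 0 {0}ᶜ) :=
        tendsto_nhdsWithin_iff.2 ⟨tendsto_pow_atTop_nhds_zero_of_lt_one (by norm_num)
          (by norm_num), Filter.Eventually.of_forall fun n => by simp⟩
      refine ((hasDerivAt_iff_tendsto_slope.1 hd).comp hs).congr fun n => ?_
      simp only [Function.comp, slope, vsub_eq_sub, smul_eq_mul]
      simp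
      exact (div_eq_mul_inv _ _).symm
    rw [ENNReal.ofReal_toReal hx] at key
    refine key.congr fun n => ?_
    unfold expQuotient
    rw [ENNReal.ofReal_mul (by positivity), ENNReal.ofReal_sub _ (Real.exp_pos _).le,
      ENNReal.ofReal_one, ← expNeg_ofReal (by positivity),
      ENNReal.ofReal_div_of_pos (by positivity), ENNReal.ofReal_toReal hx,
      ENNReal.ofReal_pow (by norm_num), ENNReal.ofReal_ofNat, ENNReal.div_eq_inv_mul]

@[fun_prop] theorem measurable_expQuotient (n : ℕ) : Measurable (expQuotient n) := by
  unfold expQuotient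
  fun_prop

/-! ### The Laplace functional of a Poisson process. -/

theorem lintegral_countingMeasure {Ω : Type*} (x : ℕ → Ω → Plane) (ω : Ω) {f : Plane → ℝ≥0∞}
    (hf : Measurable f) : ∫⁻ y, f y ∂(countingMeasure x ω) = ∑' i, f (x i ω) := by
  rw [countingMeasure, lintegral_sum_measure]
  simp [lintegral_dirac' _ hf]

theorem expNeg_mul_natCast (c : ℝ≥0∞) (n : ℕ) : expNeg (c * n) = expNeg c ^ n := by
  induction n with
  | zero => simp
  | succ n ih => rw [Nat.cast_succ, mul_add, expNeg_add, ih, mul_one, pow_succ]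

/-- Up to the factor `exp (-r (1 - z))`, the summands are the weights of the Poisson law of mean `r
z`, which add up to `1`. -/
theorem lintegral_pow_poissonMeasure (r : ℝ≥0) {z : ℝ≥0∞} (hz : z ≤ 1) :
    ∫⁻ n : ℕ, z ^ n ∂(poissonMeasure r) = expNeg (r * (1 - z)) := by
  lift z to ℝ≥0 using ne_top_of_le_ne_top ENNReal.one_ne_top hz
  have hz' : z ≤ 1 := by exact_mod_cast hz
  have hz1 : (z : ℝ) ≤ 1 := by exact_mod_cast hz
  rw [lintegral_countable']
  have h := (hasSum_one_poissonMeasure (r * z)).mul_left (Real.exp (-(r * (1 - z)) : ℝ))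
  have h2 : ∀ n : ℕ, (z : ℝ≥0∞) ^ n * poissonMeasure r {n} = ENNReal.ofReal
      (Real.exp (-(r * (1 - z)) : ℝ) * (Real.exp (-(r * z : ℝ≥0)) * (r * z : ℝ≥0) ^ n / n.factorial)) := by
    intro n
    rw [poissonMeasure_singleton, ← ENNReal.ofReal_coe_nnreal (p := z),
      ← ENNReal.ofReal_pow z.coe_nonneg, ← ENNReal.ofReal_mul (by positivity)]
    congr 1
    have : Real.exp (-r : ℝ) = Real.exp (-(r * (1 - z)) : ℝ) * Real.exp (-(r * z : ℝ≥0)) := by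
      rw [← Real.exp_add]
      congr 1
      push_cast
      ring
    rw [this]
    push_cast
    ring
  simp_rw [h2]
  rw [← ENNReal.ofReal_tsum_of_nonneg (fun n => by positivity) h.summable, h.tsum_eq, mul_one,
    ← expNeg_ofReal (mul_nonneg r.coe_nonneg (sub_nonneg.2 hz1)), ENNReal.ofReal_mul r.coe_nonneg,
    ENNReal.ofReal_sub _ z.coe_nonneg]
  simp

namespace IsHomogeneousPPP

variable {Ω : Type*} [MeasurableSpace Ω] {μ : Measure Ω} {x : ℕ → Ω → Plane} {lam : ℝ}

theorem measurable_countingMeasure_apply (hx : IsHomogeneousPPP x lam μ) {A : Set Plane}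
    (hA : MeasurableSet A) : Measurable fun ω => countingMeasure x ω A := by
  have h : (fun ω => countingMeasure x ω A) = fun ω => ∑' i, A.indicator 1 (x i ω) := by
    funext ω
    rw [← lintegral_countingMeasure x ω (measurable_one.indicator hA), lintegral_indicator_one hA]
  rw [h]
  exact Measurable.tsum fun i => (measurable_one.indicator hA).comp (hx.measurable i)

theorem measurable_tsum (hx : IsHomogeneousPPP x lam μ) {f : Plane → ℝ≥0∞}
    (hf : Measurable f) : Measurable fun ω => ∑' i, f (x i ω) :=
  Measurable.tsum fun i => hf.comp (hx.measurable i)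

theorem lintegral_expNeg_count (hx : IsHomogeneousPPP x lam μ) {A : Set Plane}
    (hA : MeasurableSet A) (hA' : volume A ≠ ∞) (c : ℝ≥0∞) :
    ∫⁻ ω, expNeg (c * countingMeasure x ω A) ∂μ =
      expNeg (ENNReal.ofReal lam * (volume A * (1 - expNeg c))) := by
  have h := hx.poisson_count A hA hA'
  rw [← lintegral_map' (f := fun y => expNeg (c * y)) (by fun_prop) h.aemeasurable, h.map_eq,
    lintegral_map (by fun_prop) (by fun_prop)]
  simp_rw [expNeg_mul_natCast]
  rw [lintegral_pow_poissonMeasure _ (expNeg_le_one c), ENNReal.coe_mul,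
    ENNReal.coe_toNNReal hA', mul_assoc]
  rfl

/-- Laplace functional of a PPP at a simple function whose nonzero values are taken on sets of
finite area. -/
theorem lintegral_expNeg_tsum_simpleFunc [IsProbabilityMeasure μ] (hx : IsHomogeneousPPP x lam μ)
    (s : SimpleFunc Plane ℝ≥0∞) (hs : ∀ c, c ≠ 0 → volume (s ⁻¹' {c}) ≠ ∞) :
    ∫⁻ ω, expNeg (∑' i, s (x i ω)) ∂μ =
      expNeg (ENNReal.ofReal lam * ∫⁻ y, (1 - expNeg (s y))) := by
  -- Grouping the points by the value of `s` leaves only the counts in its fibers, which are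
  -- disjoint and therefore carry independent counts.
  have hsum : ∀ ω, expNeg (∑' i, s (x i ω)) =
      ∏ c ∈ s.range, expNeg (c * countingMeasure x ω (s ⁻¹' {c})) := by
    intro ω
    rw [← lintegral_countingMeasure x ω s.measurable, SimpleFunc.lintegral_eq_lintegral,
      SimpleFunc.lintegral, expNeg_finsetSum]
  have hind : iIndepFun (fun (c : s.range) ω =>
      expNeg (c * countingMeasure x ω (s ⁻¹' {(c : ℝ≥0∞)}))) μ := by
    have h := hx.indep_count s.range.card (fun j => s ⁻¹' {((s.range.equivFin.symm j : s.range) : ℝ≥0∞)})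
      (fun j => s.measurableSet_fiber _) ?_
    · have h2 := (h.precomp s.range.equivFin.injective).comp
        (fun (c : s.range) (y : ℝ≥0∞) => expNeg (c * y)) (fun c => by fun_prop)
      convert! h2 using 3
      simp
    · intro a b hab
      refine Disjoint.preimage _ (Set.disjoint_singleton.2 fun h => hab ?_)
      exact s.range.equivFin.symm.injective (Subtype.ext h)
  simp_rw [hsum]
  have hrew : ∀ ω, ∏ c ∈ s.range, expNeg (c * countingMeasure x ω (s ⁻¹' {c})) =
      ∏ c ∈ s.range.attach, expNeg (c * countingMeasure x ω (s ⁻¹' {(c : ℝ≥0∞)})) := fun ω =>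
    (Finset.prod_attach s.range fun c => expNeg (c * countingMeasure x ω (s ⁻¹' {c}))).symm
  simp_rw [hrew]
  rw [lintegral_prod_eq_prod_lintegral_of_indepFun _ _ hind fun c => by
      have := hx.measurable_countingMeasure_apply (s.measurableSet_fiber (c : ℝ≥0∞))
      fun_prop,
    Finset.prod_attach s.range fun c => ∫⁻ ω, expNeg (c * countingMeasure x ω (s ⁻¹' {c})) ∂μ]
  have hint : ∫⁻ y, (1 - expNeg (s y)) =
      ∑ c ∈ s.range, (1 - expNeg c) * volume (s ⁻¹' {c}) := by
    rw [← SimpleFunc.map_lintegral (fun c => 1 - expNeg c) s, ← SimpleFunc.lintegral_eq_lintegral]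
    rfl
  rw [hint, Finset.mul_sum, expNeg_finsetSum]
  refine Finset.prod_congr rfl fun c _ => ?_
  -- The fiber over `0` may have infinite area, but its factor is trivially `1` on both sides.
  by_cases hc : c = 0
  · simp [hc]
  · rw [hx.lintegral_expNeg_count (s.measurableSet_fiber c) (hs c hc) c, mul_comm (volume _)]

/-- As `g n` increases, the left integrands decrease, so bounded convergence is used there; on the
right `1 - expNeg (g n y)` increases and monotone convergence applies. -/
theorem lintegral_expNeg_tsum_of_iSup [IsProbabilityMeasure μ] (hx : IsHomogeneousPPP x lam μ)
    {f : Plane → ℝ≥0∞} (g : ℕ → Plane → ℝ≥0∞) (hg : ∀ n, Measurable (g n))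
    (hmono : Monotone g) (hsup : ∀ y, ⨆ n, g n y = f y)
    (hL : ∀ n, ∫⁻ ω, expNeg (∑' i, g n (x i ω)) ∂μ =
      expNeg (ENNReal.ofReal lam * ∫⁻ y, (1 - expNeg (g n y)))) :
    ∫⁻ ω, expNeg (∑' i, f (x i ω)) ∂μ =
      expNeg (ENNReal.ofReal lam * ∫⁻ y, (1 - expNeg (f y))) := by
  have hlim : ∀ y, Filter.Tendsto (fun n => g n y) Filter.atTop (nhds (f y)) := fun y =>
    hsup y ▸ tendsto_atTop_iSup fun m n h => hmono h y
  have hf : Measurable f := measurable_of_tendsto_metrizable hg (tendsto_pi_nhds.2 hlim)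
  have h1 : Filter.Tendsto (fun n => ∫⁻ ω, expNeg (∑' i, g n (x i ω)) ∂μ) Filter.atTop
      (nhds (∫⁻ ω, expNeg (∑' i, f (x i ω)) ∂μ)) := by
    refine tendsto_lintegral_of_dominated_convergence (fun _ => 1)
      (fun n => measurable_expNeg.comp (hx.measurable_tsum (hg n)))
      (fun n => Filter.Eventually.of_forall fun ω => expNeg_le_one _) (by simp)
      (Filter.Eventually.of_forall fun ω => ?_)
    refine (continuous_expNeg.tendsto _).comp ?_
    simp_rw [← lintegral_countingMeasure x ω (hg _), ← lintegral_countingMeasure x ω hf]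
    exact lintegral_tendsto_of_tendsto_of_monotone (fun n => (hg n).aemeasurable)
      (Filter.Eventually.of_forall fun y m n h => hmono h y) (Filter.Eventually.of_forall hlim)
  have h2 : Filter.Tendsto (fun n => expNeg (ENNReal.ofReal lam * ∫⁻ y, (1 - expNeg (g n y))))
      Filter.atTop (nhds (expNeg (ENNReal.ofReal lam * ∫⁻ y, (1 - expNeg (f y))))) := by
    refine (continuous_expNeg.tendsto _).comp (ENNReal.Tendsto.const_mul ?_ (Or.inr (by simp)))
    refine lintegral_tendsto_of_tendsto_of_monotone (fun n => by have := hg n; fun_prop)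
      (Filter.Eventually.of_forall fun y m n h => ?_) (Filter.Eventually.of_forall fun y => ?_)
    · exact tsub_le_tsub_left (expNeg_antitone (hmono h y)) _
    · exact ENNReal.Tendsto.sub tendsto_const_nhds ((continuous_expNeg.tendsto _).comp (hlim y))
        (by simp)
  simp_rw [hL] at h1
  exact tendsto_nhds_unique h1 h2

/-- The Laplace functional of a homogeneous PPP. -/
theorem lintegral_expNeg_tsum [IsProbabilityMeasure μ] (hx : IsHomogeneousPPP x lam μ)
    {f : Plane → ℝ≥0∞} (hf : Measurable f) :
    ∫⁻ ω, expNeg (∑' i, f (x i ω)) ∂μ =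
      expNeg (ENNReal.ofReal lam * ∫⁻ y, (1 - expNeg (f y))) := by
  have hball : ∀ n : ℕ, MeasurableSet (Metric.ball (0 : Plane) n) := fun n => measurableSet_ball
  -- Cutting off at radius `n` confines the nonzero fibers to a set of finite area without spoiling
  -- the monotone limit.
  refine hx.lintegral_expNeg_tsum_of_iSup
    (fun n => (SimpleFunc.eapprox f n).restrict (Metric.ball 0 n)) (fun n => SimpleFunc.measurable _)
    ?_ ?_ fun n => ?_
  · intro m n hmn y
    simp only [SimpleFunc.restrict_apply _ (hball _)]
    refine Set.indicator_le_indicator_of_subset (Metric.ball_subset_ball (Nat.cast_le.2 hmn))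
      (fun _ => zero_le) y |>.trans ?_
    exact Set.indicator_le_indicator (SimpleFunc.monotone_eapprox f hmn y)
  · intro y
    obtain ⟨N, hN⟩ := exists_nat_gt ‖y‖
    have hmono : Monotone fun n => SimpleFunc.eapprox f n y := fun m n h =>
      SimpleFunc.monotone_eapprox f h y
    rw [← SimpleFunc.iSup_eapprox_apply hf y]
    refine le_antisymm (iSup_mono fun n => ?_) (iSup_le fun n => ?_)
    · simp only [SimpleFunc.restrict_apply _ (hball _)]
      exact Set.indicator_le_self _ _ _
    · refine le_iSup_of_le (max n N) ?_
      simp only [SimpleFunc.restrict_apply _ (hball _)]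
      rw [Set.indicator_of_mem]
      · exact hmono (le_max_left _ _)
      · rw [mem_ball_zero_iff]
        exact hN.trans_le (by exact_mod_cast le_max_right _ _)
  · refine hx.lintegral_expNeg_tsum_simpleFunc _ fun c hc => ?_
    refine ne_top_of_le_ne_top (measure_ball_lt_top (x := (0 : Plane)) (r := n)).ne
      (measure_mono fun y hy => ?_)
    by_contra hy'
    refine hc ?_
    rw [← Set.mem_singleton_iff.1 (Set.mem_preimage.1 hy), SimpleFunc.restrict_apply _ (hball _),
      Set.indicator_of_notMem hy']

end IsHomogeneousPPP

/-! ### Campbell's formula by differentiating the Laplace functional. -/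

/-- A diagonal limit: the quotient index and its argument move together. By monotonicity, freezing
the argument at a late `y m` bounds the later terms from below. -/
theorem tendsto_expQuotient_of_monotone {y : ℕ → ℝ≥0∞} {a : ℝ≥0∞} (hy : Monotone y)
    (ha : Filter.Tendsto y Filter.atTop (nhds a)) :
    Filter.Tendsto (fun n => expQuotient n (y n)) Filter.atTop (nhds a) := by
  refine tendsto_order.2 ⟨fun c hc => ?_, fun c hc => Filter.Eventually.of_forall fun n =>
    ((expQuotient_le n _).trans (hy.ge_of_tendsto ha n)).trans_lt hc⟩
  obtain ⟨m, hm⟩ := ((tendsto_order.1 ha).1 c hc).exists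
  filter_upwards [(tendsto_order.1 (tendsto_expQuotient (y m))).1 c hm, Filter.eventually_ge_atTop m]
    with n hn hmn
  exact hn.trans_le (expQuotient_mono_right n (hy hmn))

theorem one_sub_mul_eq_add {a b : ℝ≥0∞} (ha : a ≤ 1) (hb : b ≤ 1) :
    1 - a * b = (1 - a) + a * (1 - b) := by
  have ha' : a ≠ ∞ := ne_top_of_le_ne_top ENNReal.one_ne_top ha
  have hab : a * b ≤ a := mul_le_of_le_one_right' hb
  rw [ENNReal.mul_sub fun _ _ => ha', mul_one, tsub_add_tsub_cancel ha hab]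

namespace IsHomogeneousPPP

variable {Ω : Type*} [MeasurableSpace Ω] {μ : Measure Ω} [IsProbabilityMeasure μ]
  {x : ℕ → Ω → Plane} {lam : ℝ}

/-- A difference quotient of the Laplace functional at `f` in the direction `v` with step `2⁻ⁿ`;
both Laplace functionals involved are known. -/
theorem lintegral_expQuotient_mul_expNeg (hx : IsHomogeneousPPP x lam μ) {f v : Plane → ℝ≥0∞}
    (hf : Measurable f) (hv : Measurable v) (n : ℕ) :
    ∫⁻ ω, expQuotient n (∑' i, v (x i ω)) * expNeg (∑' i, f (x i ω)) ∂μ =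
      expQuotient n (ENNReal.ofReal lam * ∫⁻ y, expQuotient n (v y) * expNeg (f y)) *
        expNeg (ENNReal.ofReal lam * ∫⁻ y, (1 - expNeg (f y))) := by
  have hmf := hx.measurable_tsum hf
  have hmv := hx.measurable_tsum hv
  set s : ℝ≥0∞ := (2 ^ n)⁻¹ with hs
  have hs2 : (2 : ℝ≥0∞) ^ n * s = 1 := ENNReal.mul_inv_cancel (by simp) (by simp)
  have h1 : ∀ ω, expQuotient n (∑' i, v (x i ω)) * expNeg (∑' i, f (x i ω)) =
      2 ^ n * (expNeg (∑' i, f (x i ω)) - expNeg (∑' i, (f (x i ω) + s * v (x i ω)))) := by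
    intro ω
    rw [ENNReal.tsum_add, ENNReal.tsum_mul_left, expNeg_add, expQuotient, mul_assoc,
      ENNReal.sub_mul fun _ _ => expNeg_ne_top _, one_mul, mul_comm (expNeg (s * _))]
  have hfsv : Measurable fun y => f y + s * v y := by fun_prop
  have hmfsv := hx.measurable_tsum hfsv
  simp_rw [h1]
  rw [lintegral_const_mul _ (by fun_prop), lintegral_sub (by fun_prop)]
  rotate_left
  · refine ne_top_of_le_ne_top (b := ∫⁻ _, 1 ∂μ) (by simp) (lintegral_mono fun ω => expNeg_le_one _)
  · exact Filter.Eventually.of_forall fun ω =>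
      expNeg_antitone (ENNReal.tsum_le_tsum fun i => le_self_add)
  rw [hx.lintegral_expNeg_tsum hf, hx.lintegral_expNeg_tsum hfsv]
  -- The identity `1 - ab = (1 - a) + a (1 - b)` isolates the increment, which makes the difference
  -- on the right an `expQuotient` again.
  have h2 : ∫⁻ y, (1 - expNeg (f y + s * v y)) =
      (∫⁻ y, (1 - expNeg (f y))) + s * ∫⁻ y, expQuotient n (v y) * expNeg (f y) := by
    rw [← lintegral_const_mul _ (by fun_prop), ← lintegral_add_left (by fun_prop)]
    refine lintegral_congr fun y => ?_
    rw [expNeg_add, one_sub_mul_eq_add (expNeg_le_one _) (expNeg_le_one _), expQuotient,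
      ← mul_assoc, ← mul_assoc, mul_comm s (2 ^ n), hs2, one_mul, mul_comm (1 - _)]
  rw [h2, mul_add, expNeg_add, expQuotient, mul_assoc,
    ENNReal.sub_mul fun _ _ => expNeg_ne_top _, one_mul, mul_comm (expNeg _) (expNeg _),
    mul_left_comm _ s]

/-- Campbell's formula with an exponential weight. -/
theorem lintegral_tsum_mul_expNeg (hx : IsHomogeneousPPP x lam μ) {f v : Plane → ℝ≥0∞}
    (hf : Measurable f) (hv : Measurable v) :
    ∫⁻ ω, (∑' i, v (x i ω)) * expNeg (∑' i, f (x i ω)) ∂μ =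
      (ENNReal.ofReal lam * ∫⁻ y, v y * expNeg (f y)) *
        expNeg (ENNReal.ofReal lam * ∫⁻ y, (1 - expNeg (f y))) := by
  have hmf := hx.measurable_tsum hf
  have hmv := hx.measurable_tsum hv
  have h1 : Filter.Tendsto
      (fun n => ∫⁻ ω, expQuotient n (∑' i, v (x i ω)) * expNeg (∑' i, f (x i ω)) ∂μ) Filter.atTop
      (nhds (∫⁻ ω, (∑' i, v (x i ω)) * expNeg (∑' i, f (x i ω)) ∂μ)) := by
    refine lintegral_tendsto_of_tendsto_of_monotone (fun n => by fun_prop)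
      (Filter.Eventually.of_forall fun ω m n h => ?_) (Filter.Eventually.of_forall fun ω => ?_)
    · exact mul_le_mul_left (expQuotient_mono_left _ h) _
    · exact ENNReal.Tendsto.mul_const (tendsto_expQuotient _) (Or.inr (expNeg_ne_top _))
  have h2 : Filter.Tendsto (fun n => ENNReal.ofReal lam * ∫⁻ y, expQuotient n (v y) * expNeg (f y))
      Filter.atTop (nhds (ENNReal.ofReal lam * ∫⁻ y, v y * expNeg (f y))) := by
    refine ENNReal.Tendsto.const_mul ?_ (Or.inr ENNReal.ofReal_ne_top)
    refine lintegral_tendsto_of_tendsto_of_monotone (fun n => by fun_prop)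
      (Filter.Eventually.of_forall fun ω m n h => ?_) (Filter.Eventually.of_forall fun ω => ?_)
    · exact mul_le_mul_left (expQuotient_mono_left _ h) _
    · exact ENNReal.Tendsto.mul_const (tendsto_expQuotient _) (Or.inr (expNeg_ne_top _))
  have h3 := ENNReal.Tendsto.mul_const (b := expNeg (ENNReal.ofReal lam * ∫⁻ y, (1 - expNeg (f y))))
    (tendsto_expQuotient_of_monotone (fun m n h => by
      refine mul_le_mul_right (lintegral_mono fun y => ?_) _
      exact mul_le_mul_left (expQuotient_mono_left _ h) _) h2) (Or.inr (expNeg_ne_top _))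
  simp_rw [hx.lintegral_expQuotient_mul_expNeg hf hv] at h1
  exact tendsto_nhds_unique h1 h3

/-- Campbell's formula. -/
theorem lintegral_tsum (hx : IsHomogeneousPPP x lam μ) {v : Plane → ℝ≥0∞} (hv : Measurable v) :
    ∫⁻ ω, ∑' i, v (x i ω) ∂μ = ENNReal.ofReal lam * ∫⁻ y, v y := by
  simpa using hx.lintegral_tsum_mul_expNeg (f := fun _ => 0) measurable_const hv

end IsHomogeneousPPP

/-! ### The Campbell–Mecke formula for several independent classes. -/

section MultiClass

variable {C Ω : Type*} [Fintype C] [MeasurableSpace Ω] {μ : Measure Ω} [IsProbabilityMeasure μ]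
  {X : C → ℕ → Ω → Plane} {d : C → ℝ}

/-- The expectation factorizes over classes: class `k` contributes Campbell's formula, every other
class only its Laplace functional. -/
theorem lintegral_tsum_mul_expNeg_of_iIndepFun (hX : ∀ c, IsHomogeneousPPP (X c) (d c) μ)
    (hind : iIndepFun (fun c ω i => X c i ω) μ) {f : C → Plane → ℝ≥0∞} (hf : ∀ c, Measurable (f c))
    {v : Plane → ℝ≥0∞} (hv : Measurable v) (k : C) :
    ∫⁻ ω, (∑' i, v (X k i ω)) * expNeg (∑ c, ∑' i, f c (X c i ω)) ∂μ =
      (ENNReal.ofReal (d k) * ∫⁻ y, v y * expNeg (f k y)) *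
        expNeg (∑ c, ENNReal.ofReal (d c) * ∫⁻ y, (1 - expNeg (f c y))) := by
  classical
  let G : C → (ℕ → Plane) → ℝ≥0∞ := fun c z =>
    (if c = k then ∑' i, v (z i) else 1) * expNeg (∑' i, f c (z i))
  have hG : ∀ c, Measurable (G c) := by
    intro c
    have h1 : Measurable fun z : ℕ → Plane => ∑' i, v (z i) :=
      Measurable.tsum fun i => hv.comp (measurable_pi_apply i)
    have h2 : Measurable fun z : ℕ → Plane => ∑' i, f c (z i) :=
      Measurable.tsum fun i => (hf c).comp (measurable_pi_apply i)
    by_cases hc : c = k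
    · simp only [G, hc, if_true]
      subst hc
      fun_prop
    · simp only [G, hc, if_false]
      fun_prop
  have hseq : ∀ c, Measurable fun ω i => X c i ω := fun c =>
    measurable_pi_lambda _ fun i => (hX c).measurable i
  have h := lintegral_prod_eq_prod_lintegral_of_indepFun Finset.univ _ (hind.comp G hG)
    fun c => (hG c).comp (hseq c)
  have hl : ∀ ω, ∏ c, (G c ∘ fun ω i => X c i ω) ω =
      (∑' i, v (X k i ω)) * expNeg (∑ c, ∑' i, f c (X c i ω)) := by
    intro ω
    simp only [G, Function.comp_apply, Finset.prod_mul_distrib, expNeg_finsetSum,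
      Finset.prod_ite_eq', Finset.mem_univ, if_true]
  have hr : ∀ c, ∫⁻ ω, (G c ∘ fun ω i => X c i ω) ω ∂μ =
      (if c = k then ENNReal.ofReal (d k) * ∫⁻ y, v y * expNeg (f k y) else 1) *
        expNeg (ENNReal.ofReal (d c) * ∫⁻ y, (1 - expNeg (f c y))) := by
    intro c
    by_cases hc : c = k
    · subst hc
      simp only [G, Function.comp_def, if_true]
      exact (hX c).lintegral_tsum_mul_expNeg (hf c) hv
    · simp only [G, Function.comp_def, hc, if_false, one_mul]
      exact (hX c).lintegral_expNeg_tsum (hf c)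
  simp_rw [hl, hr] at h
  rw [h, Finset.prod_mul_distrib, expNeg_finsetSum]
  simp

end MultiClass

theorem tendsto_of_monotone_iSup {g : ℝ≥0∞ → ℝ≥0∞} {r : ℕ → ℝ≥0∞} {a : ℝ≥0∞}
    (hg : Monotone g) (hsup : ∀ r : ℕ → ℝ≥0∞, Monotone r → g (⨆ n, r n) = ⨆ n, g (r n))
    (hr : Monotone r) (ha : ⨆ n, r n = a) :
    Filter.Tendsto (fun n => g (r n)) Filter.atTop (nhds (g a)) := by
  rw [← ha, hsup r hr]
  exact tendsto_atTop_iSup fun m n h => hg (hr h)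

theorem tendsto_ennreal_tsum_of_monotone {ι : Type*} {f : ℕ → ι → ℝ≥0∞} {g : ι → ℝ≥0∞}
    (hmono : Monotone f) (h : ∀ i, Filter.Tendsto (fun n => f n i) Filter.atTop (nhds (g i))) :
    Filter.Tendsto (fun n => ∑' i, f n i) Filter.atTop (nhds (∑' i, g i)) := by
  let _ : MeasurableSpace ι := ⊤
  simp_rw [← lintegral_count]
  exact lintegral_tendsto_of_tendsto_of_monotone (fun n => measurable_from_top.aemeasurable)
    (Filter.Eventually.of_forall fun i m n hmn => hmono hmn i) (Filter.Eventually.of_forall h)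

theorem tendsto_ennreal_tsum_of_dominated {ι : Type*} {f : ℕ → ι → ℝ≥0∞} {g b : ι → ℝ≥0∞}
    (hb : ∑' i, b i ≠ ∞) (hfb : ∀ n i, f n i ≤ b i)
    (h : ∀ i, Filter.Tendsto (fun n => f n i) Filter.atTop (nhds (g i))) :
    Filter.Tendsto (fun n => ∑' i, f n i) Filter.atTop (nhds (∑' i, g i)) := by
  let _ : MeasurableSpace ι := ⊤
  rw [← lintegral_count] at hb
  simp_rw [← lintegral_count]
  exact tendsto_lintegral_of_dominated_convergence b (fun n => measurable_from_top)
    (fun n => Filter.Eventually.of_forall (hfb n)) hb (Filter.Eventually.of_forall h)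

section MultiClass

variable {C Ω : Type*} [Fintype C] [MeasurableSpace Ω] {μ : Measure Ω} [IsProbabilityMeasure μ]
  {X : C → ℕ → Ω → Plane} {d : C → ℝ}

/-- The multi-class Campbell–Mecke formula, for a weight depending on a point through a function
with finitely many values. -/
theorem lintegral_tsum_mul_expNeg_simpleFunc (hX : ∀ c, IsHomogeneousPPP (X c) (d c) μ)
    (hind : iIndepFun (fun c ω i => X c i ω) μ) {g : C → ℝ≥0∞ → Plane → ℝ≥0∞}
    (hg : ∀ c, Measurable (Function.uncurry (g c))) (s : SimpleFunc Plane ℝ≥0∞)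
    {v : Plane → ℝ≥0∞} (hv : Measurable v) (k : C) :
    ∫⁻ ω, ∑' i, v (X k i ω) * expNeg (∑ c, ∑' j, g c (s (X k i ω)) (X c j ω)) ∂μ =
      ENNReal.ofReal (d k) * ∫⁻ y, v y * (expNeg (g k (s y) y) *
        expNeg (∑ c, ENNReal.ofReal (d c) * ∫⁻ z, (1 - expNeg (g c (s y) z)))) := by
  have hgr : ∀ c r, Measurable (g c r) := fun c r => (hg c).of_uncurry_left
  have hvr : ∀ r, Measurable ((s ⁻¹' {r}).indicator v) := fun r =>
    hv.indicator (s.measurableSet_fiber r)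
  -- On a fiber of `s` the parameter is frozen, so the formula with a fixed exponent applies fiber
  -- by fiber.
  have key : ∀ (F : ℝ≥0∞ → ℝ≥0∞) (y : Plane), v y * F (s y) =
      ∑ r ∈ s.range, (s ⁻¹' {r}).indicator v y * F r := by
    intro F y
    rw [Finset.sum_eq_single (s y)]
    · rw [Set.indicator_of_mem (by simp)]
    · intro r _ hr
      rw [Set.indicator_of_notMem (by simpa using hr.symm), zero_mul]
    · intro h
      exact absurd (s.mem_range_self y) h
  have hl : ∀ ω, ∑' i, v (X k i ω) * expNeg (∑ c, ∑' j, g c (s (X k i ω)) (X c j ω)) =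
      ∑ r ∈ s.range, (∑' i, (s ⁻¹' {r}).indicator v (X k i ω)) *
        expNeg (∑ c, ∑' j, g c r (X c j ω)) := by
    intro ω
    simp_rw [key (fun r => expNeg (∑ c, ∑' j, g c r (X c j ω))), ← ENNReal.tsum_mul_right]
    exact Summable.tsum_finsetSum fun r _ => ENNReal.summable
  simp_rw [hl]
  rw [lintegral_finsetSum]
  rotate_left
  · intro r _
    have h1 := (hX k).measurable_tsum (hvr r)
    have h2 : ∀ c, Measurable fun ω => ∑' j, g c r (X c j ω) := fun c =>
      (hX c).measurable_tsum (hgr c r)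
    fun_prop
  simp_rw [lintegral_tsum_mul_expNeg_of_iIndepFun hX hind (fun c => hgr c _) (hvr _) k]
  have hr : ∀ y, v y * (expNeg (g k (s y) y) *
        expNeg (∑ c, ENNReal.ofReal (d c) * ∫⁻ z, (1 - expNeg (g c (s y) z)))) =
      ∑ r ∈ s.range, (s ⁻¹' {r}).indicator v y * (expNeg (g k r y) *
        expNeg (∑ c, ENNReal.ofReal (d c) * ∫⁻ z, (1 - expNeg (g c r z)))) := fun y =>
    key (fun r => expNeg (g k r y) *
      expNeg (∑ c, ENNReal.ofReal (d c) * ∫⁻ z, (1 - expNeg (g c r z)))) y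
  simp_rw [hr, ← mul_assoc]
  rw [lintegral_finsetSum, Finset.mul_sum]
  rotate_left
  · intro r _
    have := hgr k r
    have := hvr r
    fun_prop
  refine Finset.sum_congr rfl fun r _ => ?_
  have := hgr k r
  have := hvr r
  rw [lintegral_mul_const _ (by fun_prop), mul_assoc]

/-- The multi-class Campbell–Mecke formula, for weights that depend on the distance of a point
from the origin in a monotone and left-continuous way, over points in a set of finite area. -/
theorem lintegral_tsum_indicator_mul_expNeg (hX : ∀ c, IsHomogeneousPPP (X c) (d c) μ)
    (hind : iIndepFun (fun c ω i => X c i ω) μ) {g : C → ℝ≥0∞ → Plane → ℝ≥0∞}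
    (hg : ∀ c, Measurable (Function.uncurry (g c))) (hmono : ∀ c y, Monotone fun r => g c r y)
    (hsup : ∀ c y (r : ℕ → ℝ≥0∞), Monotone r → g c (⨆ n, r n) y = ⨆ n, g c (r n) y)
    {A : Set Plane} (hA : MeasurableSet A) (hA' : volume A ≠ ∞) (k : C) :
    ∫⁻ ω, ∑' i, A.indicator 1 (X k i ω) * expNeg (∑ c, ∑' j, g c ‖X k i ω‖ₑ (X c j ω)) ∂μ =
      ENNReal.ofReal (d k) * ∫⁻ y, A.indicator 1 y * (expNeg (g k ‖y‖ₑ y) *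
        expNeg (∑ c, ENNReal.ofReal (d c) * ∫⁻ z, (1 - expNeg (g c ‖y‖ₑ z)))) := by
  -- The distance to the origin is approximated from below by simple functions, which is why
  -- monotonicity and left-continuity of `g` suffice.
  set s : ℕ → SimpleFunc Plane ℝ≥0∞ := SimpleFunc.eapprox fun y => ‖y‖ₑ with hs
  have hsm : ∀ y, Monotone fun n => s n y := fun y m n h => SimpleFunc.monotone_eapprox _ h y
  have hss : ∀ y, ⨆ n, s n y = ‖y‖ₑ := fun y => SimpleFunc.iSup_eapprox_apply measurable_enorm y
  set v : Plane → ℝ≥0∞ := A.indicator 1 with hvdef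
  have hv : Measurable v := measurable_one.indicator hA
  have hv1 : ∀ y, v y ≤ 1 := fun y => Set.indicator_le_self' (by simp) y
  have hvt : ∀ y, v y ≠ ∞ := fun y => ne_top_of_le_ne_top ENNReal.one_ne_top (hv1 y)
  have hvint : ∫⁻ y, v y ≠ ∞ := by rwa [hvdef, lintegral_indicator_one hA]
  have hvX : ∫⁻ ω, ∑' i, v (X k i ω) ∂μ ≠ ∞ := by
    rw [(hX k).lintegral_tsum hv]
    exact ENNReal.mul_ne_top ENNReal.ofReal_ne_top hvint
  have htend : ∀ c y z, Filter.Tendsto (fun n => g c (s n y) z) Filter.atTop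
      (nhds (g c ‖y‖ₑ z)) := fun c y z =>
    tendsto_of_monotone_iSup (hmono c z) (hsup c z) (hsm y) (hss y)
  have hgm : ∀ c (φ : Ω → ℝ≥0∞) (_ : Measurable φ),
      Measurable fun ω => ∑' j, g c (φ ω) (X c j ω) := fun c φ hφ =>
    Measurable.tsum fun j => (hg c).comp (hφ.prodMk ((hX c).measurable j))
  have hmk := fun i => (hX k).measurable i
  have h1 : Filter.Tendsto (fun n => ∫⁻ ω, ∑' i, v (X k i ω) *
      expNeg (∑ c, ∑' j, g c (s n (X k i ω)) (X c j ω)) ∂μ) Filter.atTop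
      (nhds (∫⁻ ω, ∑' i, v (X k i ω) * expNeg (∑ c, ∑' j, g c ‖X k i ω‖ₑ (X c j ω)) ∂μ)) := by
    -- The integrands decrease in `n`. The dominating function is the number of points in `A`,
    -- integrable because `A` has finite area.
    refine tendsto_lintegral_of_dominated_convergence (fun ω => ∑' i, v (X k i ω)) (fun n => ?_)
      (fun n => Filter.Eventually.of_forall fun ω => ENNReal.tsum_le_tsum fun i =>
        mul_le_of_le_one_right' (expNeg_le_one _)) hvX ?_
    · refine Measurable.tsum fun i => ?_
      have := fun c => hgm c (fun ω => s n (X k i ω)) ((s n).measurable.comp (hmk i))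
      have := hmk i
      fun_prop
    · filter_upwards [ae_lt_top ((hX k).measurable_tsum hv) hvX] with ω hω
      refine tendsto_ennreal_tsum_of_dominated hω.ne
        (fun n i => mul_le_of_le_one_right' (expNeg_le_one _)) fun i => ?_
      refine ENNReal.Tendsto.const_mul ((continuous_expNeg.tendsto _).comp ?_) (Or.inr (hvt _))
      refine tendsto_finsetSum _ fun c _ => tendsto_ennreal_tsum_of_monotone
        (fun m n h j => hmono c _ (hsm _ h)) fun j => htend c _ _
  have hHm : ∀ c, Measurable fun r => ∫⁻ z, (1 - expNeg (g c r z)) := fun c => by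
    have := hg c
    refine Measurable.lintegral_prod_right' (f := fun p : ℝ≥0∞ × Plane => 1 - expNeg (g c p.1 p.2)) ?_
    exact measurable_const.sub (measurable_expNeg.comp this)
  have h2 : Filter.Tendsto (fun n => ENNReal.ofReal (d k) * ∫⁻ y, v y * (expNeg (g k (s n y) y) *
        expNeg (∑ c, ENNReal.ofReal (d c) * ∫⁻ z, (1 - expNeg (g c (s n y) z))))) Filter.atTop
      (nhds (ENNReal.ofReal (d k) * ∫⁻ y, v y * (expNeg (g k ‖y‖ₑ y) *
        expNeg (∑ c, ENNReal.ofReal (d c) * ∫⁻ z, (1 - expNeg (g c ‖y‖ₑ z)))))) := by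
    simp_rw [← expNeg_add]
    refine ENNReal.Tendsto.const_mul ?_ (Or.inr ENNReal.ofReal_ne_top)
    refine tendsto_lintegral_of_dominated_convergence v (fun n => ?_)
      (fun n => Filter.Eventually.of_forall fun y => mul_le_of_le_one_right' (expNeg_le_one _))
      hvint (Filter.Eventually.of_forall fun y => ?_)
    · have h3 : Measurable fun y => g k (s n y) y :=
        (hg k).comp ((s n).measurable.prodMk measurable_id)
      have h4 : ∀ c, Measurable fun y => ∫⁻ z, (1 - expNeg (g c (s n y) z)) := fun c =>
        (hHm c).comp (s n).measurable
      fun_prop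
    · refine ENNReal.Tendsto.const_mul ((continuous_expNeg.tendsto _).comp ?_) (Or.inr (hvt _))
      refine (htend k y y).add (tendsto_finsetSum _ fun c _ => ?_)
      refine ENNReal.Tendsto.const_mul ?_ (Or.inr ENNReal.ofReal_ne_top)
      refine lintegral_tendsto_of_tendsto_of_monotone (fun n => ?_)
        (Filter.Eventually.of_forall fun z m n h =>
          tsub_le_tsub_left (expNeg_antitone (hmono c z (hsm y h))) _)
        (Filter.Eventually.of_forall fun z => ENNReal.Tendsto.sub tendsto_const_nhds
          ((continuous_expNeg.tendsto _).comp (htend c y z)) (by simp))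
      have : Measurable (g c (s n y)) := (hg c).of_uncurry_left
      fun_prop
  simp_rw [lintegral_tsum_mul_expNeg_simpleFunc hX hind hg _ hv k] at h1
  exact tendsto_nhds_unique h1 h2

/-- The multi-class Campbell–Mecke formula, for weights that depend on the distance of a point
from the origin in a monotone and left-continuous way. -/
theorem lintegral_tsum_expNeg (hX : ∀ c, IsHomogeneousPPP (X c) (d c) μ)
    (hind : iIndepFun (fun c ω i => X c i ω) μ) {g : C → ℝ≥0∞ → Plane → ℝ≥0∞}
    (hg : ∀ c, Measurable (Function.uncurry (g c))) (hmono : ∀ c y, Monotone fun r => g c r y)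
    (hsup : ∀ c y (r : ℕ → ℝ≥0∞), Monotone r → g c (⨆ n, r n) y = ⨆ n, g c (r n) y) (k : C) :
    ∫⁻ ω, ∑' i, expNeg (∑ c, ∑' j, g c ‖X k i ω‖ₑ (X c j ω)) ∂μ =
      ENNReal.ofReal (d k) * ∫⁻ y, expNeg (g k ‖y‖ₑ y) *
        expNeg (∑ c, ENNReal.ofReal (d c) * ∫⁻ z, (1 - expNeg (g c ‖y‖ₑ z))) := by
  -- Countably many disjoint pieces of finite area cover the plane; the localized formula is summed
  -- over them.
  set A : ℕ → Set Plane := disjointed (spanningSets volume) with hAdef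
  have hA : ∀ n, MeasurableSet (A n) := fun n =>
    MeasurableSet.disjointed (fun i => measurableSet_spanningSets _ _) n
  have hA' : ∀ n, volume (A n) ≠ ∞ := fun n =>
    ((measure_mono (disjointed_le _ n)).trans_lt (measure_spanningSets_lt_top _ n)).ne
  have hone : ∀ y, ∑' n, (A n).indicator (1 : Plane → ℝ≥0∞) y = 1 := by
    intro y
    have hy : y ∈ ⋃ n, A n := by
      rw [iUnion_disjointed, iUnion_spanningSets]
      trivial
    obtain ⟨n, hn⟩ := Set.mem_iUnion.1 hy
    rw [tsum_eq_single n fun m hm => Set.indicator_of_notMem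
      (Set.disjoint_left.1 (disjoint_disjointed _ hm.symm) hn) _, Set.indicator_of_mem hn]
    rfl
  have h := fun n => lintegral_tsum_indicator_mul_expNeg hX hind hg hmono hsup (hA n) (hA' n) k
  have hgm : ∀ c i, Measurable fun ω => ∑' j, g c ‖X k i ω‖ₑ (X c j ω) := fun c i =>
    Measurable.tsum fun j => (hg c).comp (((hX k).measurable i).enorm.prodMk ((hX c).measurable j))
  have hmk := fun i => (hX k).measurable i
  have hHm : ∀ c, Measurable fun r => ∫⁻ z, (1 - expNeg (g c r z)) := fun c => by
    have := hg c
    refine Measurable.lintegral_prod_right' (f := fun p : ℝ≥0∞ × Plane => 1 - expNeg (g c p.1 p.2)) ?_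
    exact measurable_const.sub (measurable_expNeg.comp this)
  have hi : ∀ n, Measurable ((A n).indicator (1 : Plane → ℝ≥0∞)) := fun n =>
    measurable_one.indicator (hA n)
  have hl : ∫⁻ ω, ∑' i, expNeg (∑ c, ∑' j, g c ‖X k i ω‖ₑ (X c j ω)) ∂μ =
      ∑' n, ∫⁻ ω, ∑' i, (A n).indicator 1 (X k i ω) *
        expNeg (∑ c, ∑' j, g c ‖X k i ω‖ₑ (X c j ω)) ∂μ := by
    rw [← lintegral_tsum fun n => ?_]
    · refine lintegral_congr fun ω => ?_
      rw [ENNReal.tsum_comm]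
      refine tsum_congr fun i => ?_
      rw [ENNReal.tsum_mul_right, hone, one_mul]
    · refine (Measurable.tsum fun i => ?_).aemeasurable
      have := fun c => hgm c i
      have := hmk i
      have := hi n
      fun_prop
  rw [hl]
  simp_rw [h]
  rw [ENNReal.tsum_mul_left, ← lintegral_tsum fun n => ?_]
  · congr 1
    refine lintegral_congr fun y => ?_
    rw [ENNReal.tsum_mul_right, hone, one_mul]
  · have h3 : Measurable fun y : Plane => g k ‖y‖ₑ y :=
      (hg k).comp (measurable_enorm.prodMk measurable_id)
    have h4 : ∀ c, Measurable fun y : Plane => ∫⁻ z, (1 - expNeg (g c ‖y‖ₑ z)) := fun c =>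
      (hHm c).comp measurable_enorm
    have := hi n
    exact Measurable.aemeasurable (by fun_prop)

end MultiClass

/-! ### Exponential gains and coverage for fixed locations. -/

theorem lintegral_exp_neg_mul_Ioi {a : ℝ} (ha : 0 < a) (t : ℝ) :
    ∫⁻ x in Set.Ioi t, ENNReal.ofReal (Real.exp (-(a * x))) =
      ENNReal.ofReal (Real.exp (-(a * t)) / a) := by
  have h1 := integral_exp_mul_Ioi (a := -a) (by linarith) t
  have h2 := integrableOn_exp_mul_Ioi (a := -a) (by linarith) t
  simp_rw [neg_mul] at h1 h2
  rw [← ofReal_integral_eq_lintegral_ofReal h2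
    (Filter.Eventually.of_forall fun x => (Real.exp_pos _).le), h1, neg_div_neg_eq]

theorem lintegral_expMeasure_one {f : ℝ → ℝ≥0∞} (hf : Measurable f) :
    ∫⁻ x, f x ∂(expMeasure 1) = ∫⁻ x in Set.Ioi 0, ENNReal.ofReal (Real.exp (-x)) * f x := by
  have h : expMeasure 1 = volume.withDensity (exponentialPDF 1) := rfl
  have hm : Measurable (exponentialPDF 1) := (measurable_exponentialPDFReal 1).ennreal_ofReal
  rw [h, lintegral_withDensity_eq_lintegral_mul _ hm hf,
    ← lintegral_add_compl _ (measurableSet_Ici (a := (0 : ℝ)))]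
  have hneg : ∫⁻ x in (Set.Ici (0 : ℝ))ᶜ, (exponentialPDF 1 * f) x = 0 := by
    rw [setLIntegral_congr_fun (g := fun _ => 0) measurableSet_Ici.compl]
    · simp
    · intro x hx
      simp only [Pi.mul_apply]
      rw [exponentialPDF_of_neg (by simpa using hx), zero_mul]
  rw [hneg, add_zero, setLIntegral_congr Ioi_ae_eq_Ici.symm]
  refine setLIntegral_congr_fun measurableSet_Ioi fun x hx => ?_
  simp only [Pi.mul_apply]
  rw [exponentialPDF_of_nonneg (le_of_lt hx)]
  simp

/-- Gains with zero coefficient need not be measurable, so the lemma also applies to the σ-algebra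
generated by all gains but one. -/
theorem measurable_tsum_mul_ofReal {Ω : Type*} [MeasurableSpace Ω] {I : Type*} [Countable I]
    {h : I → Ω → ℝ} {c : I → ℝ≥0∞} (hc : ∀ i, c i = 0 ∨ Measurable (h i)) :
    Measurable fun ω => ∑' i, c i * ENNReal.ofReal (h i ω) :=
  Measurable.tsum fun i => by
    rcases hc i with h0 | h0
    · simp [h0]
    · fun_prop

section Fading

variable {Ω : Type*} [MeasurableSpace Ω] {μ : Measure Ω}

theorem lintegral_expNeg_mul_of_exp {h : Ω → ℝ} (hm : Measurable h)
    (hlaw : μ.map h = expMeasure 1) (c : ℝ≥0∞) :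
    ∫⁻ ω, expNeg (c * ENNReal.ofReal (h ω)) ∂μ = (1 + c)⁻¹ := by
  rw [← lintegral_map (f := fun y => expNeg (c * ENNReal.ofReal y)) (by fun_prop) hm, hlaw,
    lintegral_expMeasure_one (by fun_prop)]
  by_cases hc : c = ∞
  · subst hc
    rw [setLIntegral_congr_fun (g := fun _ => 0) measurableSet_Ioi]
    · simp
    · intro x hx
      have : ENNReal.ofReal x ≠ 0 := by simpa using hx
      simp [ENNReal.top_mul this]
  · lift c to ℝ≥0 using hc
    rw [setLIntegral_congr_fun (g := fun x => ENNReal.ofReal (Real.exp (-((1 + c : ℝ) * x))))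
      measurableSet_Ioi, lintegral_exp_neg_mul_Ioi (by positivity)]
    · rw [mul_zero, neg_zero, Real.exp_zero, one_div, ENNReal.ofReal_inv_of_pos (by positivity),
        ENNReal.ofReal_add (by norm_num) c.coe_nonneg]
      simp
    · intro x hx
      have hx' : (0 : ℝ) ≤ x := le_of_lt hx
      have : (c : ℝ≥0∞) * ENNReal.ofReal x = ENNReal.ofReal (c * x) := by
        rw [ENNReal.ofReal_mul c.coe_nonneg]; simp
      simp only
      rw [this, expNeg_ofReal (by positivity), ← ENNReal.ofReal_mul (Real.exp_pos _).le,
        ← Real.exp_add]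
      ring_nf

/-- The Laplace transform at `∞` vanishes, while its integrand equals `1` wherever the gain is not
positive. -/
theorem ae_pos_of_exp {h : Ω → ℝ} (hm : Measurable h) (hlaw : μ.map h = expMeasure 1) :
    ∀ᵐ ω ∂μ, 0 < h ω := by
  have h1 := lintegral_expNeg_mul_of_exp hm hlaw ∞
  rw [add_top, ENNReal.inv_top, lintegral_eq_zero_iff (by fun_prop)] at h1
  filter_upwards [h1] with ω hω
  by_contra hneg
  simp [ENNReal.ofReal_of_nonpos (not_lt.1 hneg)] at hω

theorem measure_le_of_exp {h : Ω → ℝ} (hm : Measurable h)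
    (hlaw : μ.map h = expMeasure 1) (t : ℝ≥0∞) :
    μ {ω | t ≤ ENNReal.ofReal (h ω)} = expNeg t := by
  by_cases ht : t = ∞
  · simp [ht]
  lift t to ℝ≥0 using ht
  have hA : MeasurableSet {y : ℝ | (t : ℝ≥0∞) ≤ ENNReal.ofReal y} :=
    measurableSet_le measurable_const (by fun_prop)
  have h1 : μ {ω | (t : ℝ≥0∞) ≤ ENNReal.ofReal (h ω)} =
      expMeasure 1 {y : ℝ | (t : ℝ≥0∞) ≤ ENNReal.ofReal y} := by
    rw [← hlaw, Measure.map_apply hm hA]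
    rfl
  rw [h1, ← lintegral_indicator_one hA, lintegral_expMeasure_one (measurable_one.indicator hA),
    ← ENNReal.ofReal_coe_nnreal, expNeg_ofReal t.coe_nonneg]
  have h2 := lintegral_exp_neg_mul_Ioi one_pos t
  simp only [one_mul, div_one] at h2
  rw [← h2, setLIntegral_congr (Ioi_ae_eq_Ici (a := (t : ℝ))), ← lintegral_indicator measurableSet_Ici,
    ← lintegral_indicator measurableSet_Ioi]
  refine lintegral_congr_ae ?_
  filter_upwards [compl_mem_ae_iff.2 (measure_singleton (0 : ℝ))] with x hx
  have hx0 : x ≠ 0 := hx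
  have ht0 : (0 : ℝ) ≤ t := t.coe_nonneg
  by_cases hx1 : (t : ℝ) ≤ x
  · have hx2 : 0 < x := lt_of_le_of_ne (ht0.trans hx1) hx0.symm
    have hx3 : ENNReal.ofReal t ≤ ENNReal.ofReal x := ENNReal.ofReal_le_ofReal hx1
    rw [ENNReal.ofReal_coe_nnreal] at hx3
    simp [Set.indicator, hx1, hx2, hx3]
  · by_cases hx2 : 0 < x
    · have hx3 : ¬ (t : ℝ≥0∞) ≤ ENNReal.ofReal x := by
        rw [← ENNReal.ofReal_coe_nnreal, ENNReal.ofReal_le_ofReal_iff hx2.le]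
        exact hx1
      simp [Set.indicator, hx1, hx2, hx3]
    · simp [Set.indicator, hx1, hx2]

theorem lintegral_indepFun {β γ : Type*} [MeasurableSpace β] [MeasurableSpace γ]
    [IsProbabilityMeasure μ] {U : Ω → β} {V : Ω → γ} (hUV : IndepFun U V μ) (hU : Measurable U)
    (hV : Measurable V) {F : β × γ → ℝ≥0∞} (hF : Measurable F) :
    ∫⁻ ω, F (U ω, V ω) ∂μ = ∫⁻ ω, ∫⁻ ω', F (U ω, V ω') ∂μ ∂μ := by
  rw [← lintegral_map (f := F) (g := fun ω => (U ω, V ω)) hF (hU.prodMk hV),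
    hUV.map_prod_eq_prod_map_map hU.aemeasurable hV.aemeasurable,
    lintegral_prod _ hF.aemeasurable, lintegral_map (hF.lintegral_prod_right') hU]
  refine lintegral_congr fun ω => ?_
  exact lintegral_map (hF.comp measurable_prodMk_left) hV

variable {I : Type*} [Countable I] {h : I → Ω → ℝ}

/-- The sum is measurable for the σ-algebra of the gains with index other than `i₀`, which is
independent of that of `h i₀`. -/
theorem indepFun_tsum_fading (hm : ∀ i, Measurable (h i)) (hind : iIndepFun h μ) {i₀ : I}
    {c : I → ℝ≥0∞} (hc : c i₀ = 0) :
    IndepFun (h i₀) (fun ω => ∑' i, c i * ENNReal.ofReal (h i ω)) μ := by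
  have hi := indep_iSup_of_disjoint (m := fun i => (inferInstance : MeasurableSpace ℝ).comap (h i))
    (fun i => (hm i).comap_le) hind.iIndep
    (S := {i₀}) (T := {i₀}ᶜ) disjoint_compl_right
  rw [IndepFun_iff_Indep]
  refine indep_of_indep_of_le_left (indep_of_indep_of_le_right hi ?_) ?_
  · rw [← measurable_iff_comap_le]
    refine @measurable_tsum_mul_ofReal Ω (_) I _ h c fun i => ?_
    by_cases h0 : i = i₀
    · exact Or.inl (h0 ▸ hc)
    · refine Or.inr ?_
      rw [measurable_iff_comap_le]
      exact le_iSup₂_of_le (f := fun i (_ : i ∈ ({i₀}ᶜ : Set I)) =>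
        (inferInstance : MeasurableSpace ℝ).comap (h i)) i h0 le_rfl
  · exact le_iSup₂_of_le i₀ rfl le_rfl

variable [IsProbabilityMeasure μ]

/-- Independence handles finite partial sums. Bounded convergence along finite subsets gives the
rest; countability of `I` makes that filter countably generated. -/
theorem lintegral_expNeg_tsum_fading (hm : ∀ i, Measurable (h i))
    (hlaw : ∀ i, μ.map (h i) = expMeasure 1) (hind : iIndepFun h μ) (c : I → ℝ≥0∞) :
    ∫⁻ ω, expNeg (∑' i, c i * ENNReal.ofReal (h i ω)) ∂μ = expNeg (∑' i, logOneAdd (c i)) := by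
  have h1 : Filter.Tendsto
      (fun s : Finset I => ∫⁻ ω, ∏ i ∈ s, expNeg (c i * ENNReal.ofReal (h i ω)) ∂μ) Filter.atTop
      (nhds (∫⁻ ω, expNeg (∑' i, c i * ENNReal.ofReal (h i ω)) ∂μ)) := by
    refine tendsto_lintegral_filter_of_dominated_convergence (fun _ => 1)
      (Filter.Eventually.of_forall fun s => ?_)
      (Filter.Eventually.of_forall fun s => Filter.Eventually.of_forall fun ω => ?_) (by simp)
      (Filter.Eventually.of_forall fun ω => tendsto_prod_expNeg _)
    · have := hm
      fun_prop
    · exact Finset.prod_le_one' fun i _ => expNeg_le_one _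
  have hind' := hind.comp (fun i y => expNeg (c i * ENNReal.ofReal y)) fun i => by fun_prop
  have h2 : ∀ s : Finset I, ∫⁻ ω, ∏ i ∈ s, expNeg (c i * ENNReal.ofReal (h i ω)) ∂μ =
      ∏ i ∈ s, expNeg (logOneAdd (c i)) := by
    intro s
    rw [show (fun ω => ∏ i ∈ s, expNeg (c i * ENNReal.ofReal (h i ω))) = fun ω => ∏ i ∈ s,
      ((fun y => expNeg (c i * ENNReal.ofReal y)) ∘ h i) ω from rfl,
      lintegral_prod_eq_prod_lintegral_of_indepFun s _ hind' fun i => by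
        have := hm i
        fun_prop]
    refine Finset.prod_congr rfl fun i _ => ?_
    rw [expNeg_logOneAdd]
    exact lintegral_expNeg_mul_of_exp (hm i) (hlaw i) _
  simp_rw [h2] at h1
  exact tendsto_nhds_unique h1 (tendsto_prod_expNeg _)

/-- Coverage probability under Rayleigh fading for fixed mean received powers. -/
theorem measure_coverage_fading [DecidableEq I] (hm : ∀ i, Measurable (h i))
    (hlaw : ∀ i, μ.map (h i) = expMeasure 1) (hind : iIndepFun h μ) (i₀ : I) (b : I → ℝ≥0∞)
    {t : ℝ≥0∞} (hb : b i₀ ≠ 0) (hb' : b i₀ ≠ ∞) :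
    μ {ω | t ≤ b i₀ * ENNReal.ofReal (h i₀ ω) /
        ∑' i, if i = i₀ then 0 else b i * ENNReal.ofReal (h i ω)} =
      expNeg (∑' i, if i = i₀ then 0 else logOneAdd (t / b i₀ * b i)) := by
  set c : I → ℝ≥0∞ := fun i => if i = i₀ then 0 else t / b i₀ * b i with hc
  have hS : Measurable fun ω => ∑' i, c i * ENNReal.ofReal (h i ω) :=
    Measurable.tsum fun i => by
      have := hm i
      fun_prop
  -- Almost surely the signal is neither `0` nor `∞`, so the quotient can be cleared even if the
  -- interference is `0` or `∞`.
  have hset : {ω | t ≤ b i₀ * ENNReal.ofReal (h i₀ ω) /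
        ∑' i, if i = i₀ then 0 else b i * ENNReal.ofReal (h i ω)} =ᵐ[μ]
      {ω | ∑' i, c i * ENNReal.ofReal (h i ω) ≤ ENNReal.ofReal (h i₀ ω)} := by
    filter_upwards [ae_pos_of_exp (hm i₀) (hlaw i₀)] with ω hω
    have hne : b i₀ * ENNReal.ofReal (h i₀ ω) ≠ 0 := by simp [hb, hω]
    have hnt : b i₀ * ENNReal.ofReal (h i₀ ω) ≠ ∞ := ENNReal.mul_ne_top hb' ENNReal.ofReal_ne_top
    have hsum : ∑' i, c i * ENNReal.ofReal (h i ω) =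
        t * (∑' i, if i = i₀ then 0 else b i * ENNReal.ofReal (h i ω)) / b i₀ := by
      rw [div_eq_mul_inv, mul_right_comm, ← div_eq_mul_inv, ← ENNReal.tsum_mul_left]
      refine tsum_congr fun i => ?_
      by_cases hi : i = i₀ <;> simp [c, hi, mul_assoc]
    refine propext ?_
    change t ≤ _ ↔ _ ≤ _
    rw [hsum, ENNReal.le_div_iff_mul_le (Or.inr hne) (Or.inr hnt),
      ENNReal.div_le_iff hb hb', mul_comm (b i₀)]
  have hm2 : MeasurableSet {p : ℝ≥0∞ × ℝ | p.1 ≤ ENNReal.ofReal p.2} :=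
    measurableSet_le (by fun_prop) (by fun_prop)
  have hm3 : MeasurableSet {ω | ∑' i, c i * ENNReal.ofReal (h i ω) ≤ ENNReal.ofReal (h i₀ ω)} :=
    measurableSet_le hS (by have := hm i₀; fun_prop)
  rw [measure_congr hset, ← lintegral_indicator_one hm3]
  -- With the interference frozen at `s`, the exponential tail of `h i₀` gives probability `expNeg
  -- s`.
  have hfub := lintegral_indepFun (indepFun_tsum_fading hm hind (i₀ := i₀) (c := c) (by simp [c])).symm
    hS (hm i₀) (F := {p : ℝ≥0∞ × ℝ | p.1 ≤ ENNReal.ofReal p.2}.indicator 1)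
    (measurable_one.indicator hm2)
  refine Eq.trans hfub ?_
  have hin : ∀ s : ℝ≥0∞, ∫⁻ ω', {p : ℝ≥0∞ × ℝ | p.1 ≤ ENNReal.ofReal p.2}.indicator 1 (s, h i₀ ω') ∂μ =
      expNeg s := by
    intro s
    rw [← measure_le_of_exp (hm i₀) (hlaw i₀) s, ← lintegral_indicator_one
      (measurableSet_le measurable_const (by have := hm i₀; fun_prop))]
    rfl
  simp_rw [hin]
  rw [lintegral_expNeg_tsum_fading hm hlaw hind c]
  congr 1
  refine tsum_congr fun i => ?_
  by_cases hi : i = i₀ <;> simp [c, hi]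

end Fading

/-! ### Radial integrals and the hypergeometric function. -/

/-- Integration of radial functions in the plane, in terms of the squared radius. -/
theorem lintegral_plane_norm_sq {G : ℝ → ℝ≥0∞} (hG : Measurable G) :
    ∫⁻ y : Plane, G (‖y‖ ^ 2) = ENNReal.ofReal Real.pi * ∫⁻ v in Set.Ioi 0, G v := by
  have hm : Measurable fun y : Plane => ‖y‖ ^ 2 := by fun_prop
  have hpre : ∀ a b : ℝ, (fun y : Plane => ‖y‖ ^ 2) ⁻¹' Set.Ico a b =
      Metric.ball 0 (Real.sqrt b) \ Metric.ball 0 (Real.sqrt a) := by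
    intro a b
    ext y
    simp [Real.lt_sqrt (norm_nonneg y), and_comm]
  have hball : ∀ a : ℝ, volume (Metric.ball (0 : Plane) (Real.sqrt a)) =
      ENNReal.ofReal (Real.pi * max a 0) := by
    intro a
    rw [EuclideanSpace.volume_ball_fin_two, ← ENNReal.ofReal_pow (Real.sqrt_nonneg _),
      ENNReal.ofReal_mul Real.pi_pos.le]
    have h : Real.sqrt a ^ 2 = max a 0 := by
      rcases le_total a 0 with h | h
      · rw [Real.sqrt_eq_zero_of_nonpos h, max_eq_right h]
        norm_num
      · rw [Real.sq_sqrt h, max_eq_left h]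
    rw [h]
    exact mul_comm _ _
  -- The disc of squared radius `v` has area `π v`, so the squared norm pushes area to `π` times
  -- Lebesgue measure; half-open intervals determine it.
  have hmap : (volume : Measure Plane).map (fun y => ‖y‖ ^ 2) =
      ENNReal.ofReal Real.pi • volume.restrict (Set.Ioi (0 : ℝ)) := by
    refine Measure.ext_of_Ico' _ _ (fun a b hab => ?_) fun a b hab => ?_
    · rw [Measure.map_apply hm measurableSet_Ico, hpre]
      exact ne_top_of_le_ne_top measure_ball_lt_top.ne (measure_mono Set.sdiff_subset)
    · rw [Measure.map_apply hm measurableSet_Ico, hpre, measure_sdiff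
        (Metric.ball_subset_ball (Real.sqrt_le_sqrt hab.le)) measurableSet_ball.nullMeasurableSet
        measure_ball_lt_top.ne, hball, hball, Measure.smul_apply,
        Measure.restrict_apply measurableSet_Ico, ← ENNReal.ofReal_sub _ (by positivity), smul_eq_mul]
      have h : volume (Set.Ico a b ∩ Set.Ioi 0) = ENNReal.ofReal (max b 0 - max a 0) := by
        rw [measure_congr (Filter.EventuallyEq.inter (ae_eq_refl (Set.Ico a b)) Ioi_ae_eq_Ici),
          Set.Ico_inter_Ici, Real.volume_Ico]
        rcases le_total b 0 with h | h
        · rw [ENNReal.ofReal_of_nonpos, max_eq_right h, max_eq_right (hab.le.trans h)]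
          · simp
          · have := le_max_right a 0
            linarith
        · rw [max_eq_left h]
      rw [h, ← ENNReal.ofReal_mul Real.pi_pos.le, mul_sub]
  rw [← lintegral_map hG hm, hmap, lintegral_smul_measure, smul_eq_mul]

/-- Substitution `v = m t^(-δ)`. With `δ = 2/α`, the path loss `v^(-α/2)` becomes proportional to
`t`, and distant points correspond to small `t`. -/
theorem lintegral_Ioi_comp_rpow {m δ : ℝ} (hm : 0 < m) (hδ : 0 < δ) (G : ℝ → ℝ≥0∞) :
    ∫⁻ v in Set.Ioi 0, G v =
      ∫⁻ t in Set.Ioi 0, ENNReal.ofReal (m * δ * t ^ (-δ - 1)) * G (m * t ^ (-δ)) := by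
  have himg : (fun t : ℝ => m * t ^ (-δ)) '' Set.Ioi 0 = Set.Ioi 0 := by
    ext v
    constructor
    · rintro ⟨t, ht, rfl⟩
      exact mul_pos hm (Real.rpow_pos_of_pos ht _)
    · intro hv
      refine ⟨(v / m) ^ (-δ⁻¹), Real.rpow_pos_of_pos (div_pos hv hm) _, ?_⟩
      simp only
      rw [← Real.rpow_mul (div_pos hv hm).le, neg_mul_neg, inv_mul_cancel₀ hδ.ne', Real.rpow_one,
        mul_div_cancel₀ _ hm.ne']
  have hinj : Set.InjOn (fun t : ℝ => m * t ^ (-δ)) (Set.Ioi 0) := by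
    intro s hs t ht hst
    have h := mul_left_cancel₀ hm.ne' hst
    exact (Real.rpow_left_inj (le_of_lt hs) (le_of_lt ht) (neg_ne_zero.2 hδ.ne')).1 h
  have hder : ∀ t ∈ Set.Ioi (0 : ℝ), HasDerivWithinAt (fun t : ℝ => m * t ^ (-δ))
      (m * (-δ * t ^ (-δ - 1))) (Set.Ioi 0) t := fun t ht =>
    ((Real.hasDerivAt_rpow_const (Or.inl (ne_of_gt ht))).const_mul m).hasDerivWithinAt
  have h := lintegral_image_eq_lintegral_abs_deriv_mul measurableSet_Ioi hder hinj G
  rw [himg] at h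
  rw [h]
  refine setLIntegral_congr_fun measurableSet_Ioi fun t ht => ?_
  congr 2
  have h1 : 0 < t ^ (-δ - 1) := Real.rpow_pos_of_pos ht _
  rw [show m * (-δ * t ^ (-δ - 1)) = -(m * δ * t ^ (-δ - 1)) by ring, abs_neg,
    abs_of_pos (by positivity)]

theorem lintegral_rpow_mul_exp_neg_mul_Ioi {a r : ℝ} (ha : 0 < a) (hr : 0 < r) :
    ∫⁻ t in Set.Ioi 0, ENNReal.ofReal (t ^ (a - 1) * Real.exp (-(r * t))) =
      ENNReal.ofReal ((1 / r) ^ a * Real.Gamma a) := by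
  have h := Real.integral_rpow_mul_exp_neg_mul_Ioi ha hr
  have hpos : 0 < (1 / r) ^ a * Real.Gamma a :=
    mul_pos (Real.rpow_pos_of_pos (by positivity) _) (Real.Gamma_pos_of_pos ha)
  rw [← h, ofReal_integral_eq_lintegral_ofReal]
  · by_contra hni
    rw [integral_undef hni] at h
    exact hpos.ne h
  · refine (ae_restrict_iff' measurableSet_Ioi).2 (Filter.Eventually.of_forall fun t ht => ?_)
    exact mul_nonneg (Real.rpow_nonneg (le_of_lt ht) _) (Real.exp_pos _).le

/-- Write `1 / (1 + t)` as `∫ exp (-(1 + t) s) ds` and swap: the result is `Γ(δ) Γ(1 - δ)`,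
evaluated by the reflection formula. -/
theorem lintegral_rpow_neg_div_one_add {δ : ℝ} (h0 : 0 < δ) (h1 : δ < 1) :
    ∫⁻ t in Set.Ioi 0, ENNReal.ofReal (t ^ (-δ) / (1 + t)) =
      ENNReal.ofReal (Real.pi / Real.sin (Real.pi * δ)) := by
  have hstep : ∀ t ∈ Set.Ioi (0 : ℝ), ENNReal.ofReal (t ^ (-δ) / (1 + t)) =
      ∫⁻ s in Set.Ioi 0, ENNReal.ofReal (t ^ (-δ) * Real.exp (-((1 + t) * s))) := by
    intro t ht
    have ht' : (0 : ℝ) < t := ht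
    have hp : 0 ≤ t ^ (-δ) := Real.rpow_nonneg ht'.le _
    simp_rw [ENNReal.ofReal_mul hp]
    rw [lintegral_const_mul _ (by fun_prop), lintegral_exp_neg_mul_Ioi (by positivity),
      ← ENNReal.ofReal_mul hp]
    simp [div_eq_mul_inv]
  rw [setLIntegral_congr_fun measurableSet_Ioi hstep, lintegral_lintegral_swap (by fun_prop)]
  have hstep2 : ∀ s ∈ Set.Ioi (0 : ℝ),
      ∫⁻ t in Set.Ioi 0, ENNReal.ofReal (t ^ (-δ) * Real.exp (-((1 + t) * s))) =
        ENNReal.ofReal (Real.Gamma (1 - δ)) *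
          ENNReal.ofReal (s ^ (δ - 1) * Real.exp (-(1 * s))) := by
    intro s hs
    have hs' : (0 : ℝ) < s := hs
    have h := lintegral_rpow_mul_exp_neg_mul_Ioi (a := 1 - δ) (r := s) (by linarith) hs'
    have he : ∀ t : ℝ, ENNReal.ofReal (t ^ (-δ) * Real.exp (-((1 + t) * s))) =
        ENNReal.ofReal (Real.exp (-s)) * ENNReal.ofReal (t ^ (1 - δ - 1) * Real.exp (-(s * t))) := by
      intro t
      rw [← ENNReal.ofReal_mul (Real.exp_pos _).le]
      congr 1
      rw [show (1 - δ - 1) = -δ by ring, show -((1 + t) * s) = -s + -(s * t) by ring, Real.exp_add]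
      ring
    simp_rw [he]
    rw [lintegral_const_mul _ (by fun_prop), h, ← ENNReal.ofReal_mul (Real.exp_pos _).le,
      ← ENNReal.ofReal_mul (Real.Gamma_pos_of_pos (by linarith)).le, one_div, one_mul,
      Real.inv_rpow hs'.le, ← Real.rpow_neg hs'.le, neg_sub]
    congr 1
    ring
  rw [setLIntegral_congr_fun measurableSet_Ioi hstep2, lintegral_const_mul _ (by fun_prop),
    lintegral_rpow_mul_exp_neg_mul_Ioi h0 one_pos,
    ← ENNReal.ofReal_mul (Real.Gamma_pos_of_pos (by linarith)).le, ← Real.Gamma_mul_Gamma_one_sub]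
  congr 1
  simp
  ring

/-- In the variable `t`, the range `t > 1` is the exclusion disc, whose normalized area is `1`. -/
theorem lintegral_rpow_Ioi_one {δ : ℝ} (hδ : 0 < δ) :
    ∫⁻ t in Set.Ioi 1, ENNReal.ofReal (δ * t ^ (-δ - 1)) = 1 := by
  have h := integral_Ioi_rpow_of_lt (a := -δ - 1) (by linarith) one_pos
  have hi := integrableOn_Ioi_rpow_of_lt (a := -δ - 1) (by linarith) one_pos
  rw [← ofReal_integral_eq_lintegral_ofReal (hi.const_mul δ), integral_const_mul, h]
  · simp
    field_simp
  · refine (ae_restrict_iff' measurableSet_Ioi).2 (Filter.Eventually.of_forall fun t ht => ?_)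
    exact mul_nonneg hδ.le (Real.rpow_nonneg (zero_le_one.trans (le_of_lt ht)) _)

/-- Here `c - b = 1`, so the power of `1 - t` in Euler's integral is trivial and the Gamma quotient
reduces to `1 - δ`. -/
theorem gaussHypergeometric_one_eq {δ : ℝ} (h1 : δ < 1) (θ : ℝ) :
    gaussHypergeometric 1 (1 - δ) (2 - δ) (-θ) =
      (1 - δ) * ∫ t in (0 : ℝ)..1, t ^ (-δ) / (1 + θ * t) := by
  have hG : Real.Gamma (1 - δ) ≠ 0 := (Real.Gamma_pos_of_pos (by linarith)).ne'
  unfold gaussHypergeometric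
  rw [show 2 - δ - (1 - δ) = 1 by ring, Real.Gamma_one, show 2 - δ = (1 - δ) + 1 by ring,
    Real.Gamma_add_one (by linarith), mul_one, mul_div_assoc, div_self hG, mul_one]
  congr 1
  refine intervalIntegral.integral_congr fun t _ => ?_
  rw [show 1 - δ - 1 = -δ by ring, show (1 : ℝ) - 1 = 0 by ring, Real.rpow_zero, mul_one,
    Real.rpow_neg_one, neg_mul, sub_neg_eq_add, div_eq_mul_inv]

theorem lintegral_Ioc_rpow_div_one_add {δ θ : ℝ} (h0 : 0 < δ) (h1 : δ < 1) (hθ : 0 ≤ θ) :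
    ∫⁻ t in Set.Ioc 0 1, ENNReal.ofReal (δ * t ^ (-δ - 1) * (θ * t / (1 + θ * t))) =
      ENNReal.ofReal (θ * δ / (1 - δ) * gaussHypergeometric 1 (1 - δ) (2 - δ) (-θ)) := by
  have hint : IntervalIntegrable (fun t : ℝ => t ^ (-δ) / (1 + θ * t)) volume 0 1 := by
    have h := intervalIntegral.intervalIntegrable_rpow' (a := 0) (b := 1) (r := -δ) (by linarith)
    simp_rw [div_eq_mul_inv]
    refine h.mul_continuousOn ?_
    refine ContinuousOn.inv₀ (by fun_prop) fun t ht => ?_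
    rw [Set.uIcc_of_le zero_le_one] at ht
    have : 0 ≤ θ * t := mul_nonneg hθ ht.1
    positivity
  rw [gaussHypergeometric_one_eq h1, ← mul_assoc, div_mul_cancel₀ _ (by linarith),
    ← intervalIntegral.integral_const_mul, intervalIntegral.integral_of_le zero_le_one,
    ofReal_integral_eq_lintegral_ofReal (hint.const_mul _).1]
  · refine setLIntegral_congr_fun measurableSet_Ioc fun t ht => ?_
    congr 1
    have : t ^ (-δ) = t ^ (-δ - 1) * t := by
      rw [← Real.rpow_add_one ht.1.ne']
      ring_nf
    rw [this]
    ring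
  · refine (ae_restrict_iff' measurableSet_Ioc).2 (Filter.Eventually.of_forall fun t ht => ?_)
    have h2 : 0 ≤ t ^ (-δ) := Real.rpow_nonneg ht.1.le _
    have h3 : 0 ≤ θ * t := mul_nonneg hθ ht.1.le
    simp only [Pi.zero_apply]
    positivity

/-! ### The exponent of a single node and its integral over the plane. -/

/-- The log-weight of a node at location `y` when the serving base station is at distance `r`:
it is infinite if the node lies within distance `ρ * r` of the origin, and otherwise accounts for
the interference from the node under Rayleigh fading. -/
noncomputable def nodeExponent (α ρ κ : ℝ) (r : ℝ≥0∞) (y : Plane) : ℝ≥0∞ :=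
  ∞ * (ENNReal.ofReal ρ * r - ‖y‖ₑ) + logOneAdd (ENNReal.ofReal κ * r ^ α * ‖y‖ₑ ^ (-α))

theorem measurable_nodeExponent (α ρ κ : ℝ) :
    Measurable (Function.uncurry (nodeExponent α ρ κ)) := by
  have h1 : Measurable fun p : ℝ≥0∞ × Plane => ‖p.2‖ₑ := measurable_enorm.comp measurable_snd
  unfold nodeExponent Function.uncurry
  fun_prop

theorem monotone_nodeExponent {α : ℝ} (hα : 0 ≤ α) (ρ κ : ℝ) (y : Plane) :
    Monotone fun r => nodeExponent α ρ κ r y := fun r s hrs => by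
  unfold nodeExponent
  refine add_le_add ?_ (monotone_logOneAdd ?_)
  · gcongr
  · have : r ^ α ≤ s ^ α := ENNReal.rpow_le_rpow hrs hα
    gcongr

/-- Truncated subtraction imposes the penalty only for `‖y‖ < ρ r`, a strict inequality; this makes
the jump left-continuous in `r`, as the Campbell–Mecke formula requires. -/
theorem nodeExponent_iSup {α : ℝ} (hα : 0 ≤ α) (ρ κ : ℝ) (y : Plane) {r : ℕ → ℝ≥0∞}
    (hr : Monotone r) :
    nodeExponent α ρ κ (⨆ n, r n) y = ⨆ n, nodeExponent α ρ κ (r n) y := by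
  unfold nodeExponent
  have hpow : Monotone fun n => r n ^ α := fun m n h => ENNReal.rpow_le_rpow (hr h) hα
  have h1 : (⨆ n, r n) ^ α = ⨆ n, r n ^ α :=
    Monotone.map_ciSup_of_continuousAt (f := fun x : ℝ≥0∞ => x ^ α)
      ENNReal.continuous_rpow_const.continuousAt (ENNReal.monotone_rpow_of_nonneg hα)
      (OrderTop.bddAbove _)
  have h2 : ∀ z : ℕ → ℝ≥0∞, logOneAdd (⨆ n, z n) = ⨆ n, logOneAdd (z n) := fun z =>
    Monotone.map_ciSup_of_continuousAt continuous_logOneAdd.continuousAt monotone_logOneAdd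
      (OrderTop.bddAbove _)
  rw [h1, ENNReal.mul_iSup, ENNReal.mul_iSup, ENNReal.iSup_mul, h2, ENNReal.iSup_sub,
    ENNReal.mul_iSup, ENNReal.iSup_add_iSup_of_monotone]
  · exact fun m n h => by
      have := hr h
      gcongr
  · exact fun m n h => monotone_logOneAdd (by
      have : r m ^ α ≤ r n ^ α := hpow h
      gcongr)

theorem one_sub_inv_one_add {w : ℝ} (hw : 0 ≤ w) :
    1 - (1 + ENNReal.ofReal w)⁻¹ = ENNReal.ofReal (w / (1 + w)) := by
  rw [← ENNReal.ofReal_one, ← ENNReal.ofReal_add zero_le_one hw,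
    ← ENNReal.ofReal_inv_of_pos (by positivity), ← ENNReal.ofReal_sub _ (by positivity)]
  congr 1
  field_simp
  ring

open Classical in
theorem one_sub_expNeg_nodeExponent {α ρ κ r : ℝ} (hρ : 0 ≤ ρ) (hκ : 0 ≤ κ) (hr : 0 < r)
    {z : Plane} (hz : z ≠ 0) :
    1 - expNeg (nodeExponent α ρ κ (ENNReal.ofReal r) z) =
      if ‖z‖ ^ 2 < (ρ * r) ^ 2 then 1 else
        ENNReal.ofReal (κ * r ^ α * (‖z‖ ^ 2) ^ (-(α / 2)) /
          (1 + κ * r ^ α * (‖z‖ ^ 2) ^ (-(α / 2)))) := by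
  have hz' : 0 < ‖z‖ := norm_pos_iff.2 hz
  have hcond : ENNReal.ofReal ρ * ENNReal.ofReal r - ‖z‖ₑ = 0 ↔ ¬ ‖z‖ ^ 2 < (ρ * r) ^ 2 := by
    rw [tsub_eq_zero_iff_le, ← ENNReal.ofReal_mul hρ, ← ofReal_norm,
      ENNReal.ofReal_le_ofReal_iff hz'.le, not_lt,
      pow_le_pow_iff_left₀ (by positivity) hz'.le two_ne_zero]
  have hw : ENNReal.ofReal κ * ENNReal.ofReal r ^ α * ‖z‖ₑ ^ (-α) =
      ENNReal.ofReal (κ * r ^ α * (‖z‖ ^ 2) ^ (-(α / 2))) := by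
    have h1 : (‖z‖ ^ 2) ^ (-(α / 2)) = ‖z‖ ^ (-α) := by
      rw [← Real.rpow_natCast, ← Real.rpow_mul hz'.le]
      congr 1
      push_cast
      ring
    rw [h1, ← ofReal_norm, ENNReal.ofReal_rpow_of_pos hr, ENNReal.ofReal_rpow_of_pos hz',
      ENNReal.ofReal_mul (by positivity), ENNReal.ofReal_mul hκ]
  unfold nodeExponent
  rw [expNeg_add, expNeg_top_mul, expNeg_logOneAdd, hw]
  by_cases h : ‖z‖ ^ 2 < (ρ * r) ^ 2
  · rw [if_pos h, if_neg (fun h' => hcond.1 h' h), zero_mul, tsub_zero]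
  · rw [if_neg h, if_pos (hcond.2 h), one_mul, one_sub_inv_one_add (by positivity)]

open Classical in
theorem lintegral_one_sub_expNeg_nodeExponent {α ρ κ r : ℝ} (hρ : 0 ≤ ρ) (hκ : 0 ≤ κ)
    (hr : 0 < r) :
    ∫⁻ z, (1 - expNeg (nodeExponent α ρ κ (ENNReal.ofReal r) z)) =
      ENNReal.ofReal Real.pi * ∫⁻ v in Set.Ioi 0, if v < (ρ * r) ^ 2 then 1 else
        ENNReal.ofReal (κ * r ^ α * v ^ (-(α / 2)) / (1 + κ * r ^ α * v ^ (-(α / 2)))) := by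
  rw [← lintegral_plane_norm_sq]
  · refine lintegral_congr_ae ?_
    filter_upwards [compl_mem_ae_iff.2 (measure_singleton (0 : Plane))] with z hz
    exact one_sub_expNeg_nodeExponent hρ hκ hr hz
  · exact Measurable.ite measurableSet_Iio measurable_const (by fun_prop)

/-- The exponent in the Laplace functional of interferers that may be arbitrarily close. -/
theorem lintegral_one_sub_expNeg_nodeExponent_zero {α κ r : ℝ} (hα : 2 < α) (hκ : 0 ≤ κ)
    (hr : 0 < r) :
    ∫⁻ z, (1 - expNeg (nodeExponent α 0 κ (ENNReal.ofReal r) z)) =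
      ENNReal.ofReal (Real.pi * r ^ 2 * (κ ^ (2 / α) / Real.sinc (Real.pi * (2 / α)))) := by
  classical
  have hα0 : 0 < α := by linarith
  have hδ : 0 < 2 / α := by positivity
  have hδ1 : 2 / α < 1 := by rwa [div_lt_one hα0]
  rw [lintegral_one_sub_expNeg_nodeExponent le_rfl hκ hr]
  -- For `κ = 0` the scale of the substitution below would vanish.
  rcases hκ.eq_or_lt with rfl | hκ
  · rw [Real.zero_rpow hδ.ne']
    simp only [zero_mul, zero_div, mul_zero, ENNReal.ofReal_zero]
    rw [setLIntegral_congr_fun (g := fun _ => 0) measurableSet_Ioi]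
    · simp
    · intro v hv
      have : ¬ v < 0 ^ 2 := by simpa using le_of_lt hv
      simp only [this, if_false]
  -- This scale is the one for which `κ r^α v^(-α/2)` is exactly `t`.
  have hm : 0 < κ ^ (2 / α) * r ^ 2 := by positivity
  rw [lintegral_Ioi_comp_rpow hm hδ, setLIntegral_congr_fun (g := fun t => ENNReal.ofReal
    (κ ^ (2 / α) * r ^ 2 * (2 / α)) * ENNReal.ofReal (t ^ (-(2 / α)) / (1 + t))) measurableSet_Ioi,
    lintegral_const_mul _ (by fun_prop), lintegral_rpow_neg_div_one_add hδ hδ1,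
    ← ENNReal.ofReal_mul (by positivity), ← ENNReal.ofReal_mul Real.pi_pos.le]
  · congr 1
    rw [Real.sinc_of_ne_zero (by positivity)]
    have : Real.sin (Real.pi * (2 / α)) ≠ 0 :=
      (Real.sin_pos_of_pos_of_lt_pi (by positivity) (by nlinarith [Real.pi_pos])).ne'
    field_simp
  · intro t ht
    have ht' : (0 : ℝ) < t := ht
    have hnot : ¬ κ ^ (2 / α) * r ^ 2 * t ^ (-(2 / α)) < (0 * r) ^ 2 := by
      rw [zero_mul, zero_pow two_ne_zero, not_lt]
      positivity
    have hw : κ * r ^ α * (κ ^ (2 / α) * r ^ 2 * t ^ (-(2 / α))) ^ (-(α / 2)) = t := by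
      rw [Real.mul_rpow (by positivity) (by positivity), Real.mul_rpow (by positivity)
        (by positivity), ← Real.rpow_mul hκ.le, ← Real.rpow_mul ht'.le, ← Real.rpow_natCast,
        ← Real.rpow_mul hr.le, show 2 / α * -(α / 2) = -1 by field_simp,
        show -(2 / α) * -(α / 2) = 1 by field_simp,
        show ((2 : ℕ) : ℝ) * -(α / 2) = -α by push_cast; ring, Real.rpow_neg_one,
        Real.rpow_neg hr.le, Real.rpow_one]
      have : r ^ α ≠ 0 := (Real.rpow_pos_of_pos hr _).ne'
      field_simp
    simp only [hnot, if_false, hw]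
    rw [← ENNReal.ofReal_mul (by positivity), ← ENNReal.ofReal_mul (by positivity)]
    congr 1
    have : t ^ (-(2 / α)) = t ^ (-(2 / α) - 1) * t := by
      rw [← Real.rpow_add_one ht'.ne']
      ring_nf
    rw [this]
    ring

/-- The exponent in the Laplace functional of interferers outside an exclusion disc. -/
theorem lintegral_one_sub_expNeg_nodeExponent_exclusion {α θ ρ r : ℝ} (hα : 2 < α) (hθ : 0 ≤ θ)
    (hρ : 0 < ρ) (hr : 0 < r) :
    ∫⁻ z, (1 - expNeg (nodeExponent α ρ (θ * ρ ^ α) (ENNReal.ofReal r) z)) =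
      ENNReal.ofReal (Real.pi * r ^ 2 * (ρ ^ 2 * (1 + 2 * θ / (α - 2) *
        gaussHypergeometric 1 (1 - 2 / α) (2 - 2 / α) (-θ)))) := by
  classical
  have hα0 : 0 < α := by linarith
  have hδ : 0 < 2 / α := by positivity
  have hδ1 : 2 / α < 1 := by rwa [div_lt_one hα0]
  -- With this scale the boundary of the exclusion disc sits at `t = 1`, and the interference ratio
  -- becomes `θ t`.
  have hm : 0 < (ρ * r) ^ 2 := by positivity
  rw [lintegral_one_sub_expNeg_nodeExponent hρ.le (by positivity) hr, lintegral_Ioi_comp_rpow hm hδ]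
  set H := fun t : ℝ => if 1 < t then ENNReal.ofReal (2 / α * t ^ (-(2 / α) - 1)) else
    ENNReal.ofReal (2 / α * t ^ (-(2 / α) - 1) * (θ * t / (1 + θ * t))) with hH
  have hHm : Measurable H := Measurable.ite measurableSet_Ioi (by fun_prop) (by fun_prop)
  have hcongr : ∀ t ∈ Set.Ioi (0 : ℝ), ENNReal.ofReal ((ρ * r) ^ 2 * (2 / α) * t ^ (-(2 / α) - 1)) *
      (if (ρ * r) ^ 2 * t ^ (-(2 / α)) < (ρ * r) ^ 2 then 1 else
        ENNReal.ofReal (θ * ρ ^ α * r ^ α * ((ρ * r) ^ 2 * t ^ (-(2 / α))) ^ (-(α / 2)) /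
          (1 + θ * ρ ^ α * r ^ α * ((ρ * r) ^ 2 * t ^ (-(2 / α))) ^ (-(α / 2))))) =
      ENNReal.ofReal ((ρ * r) ^ 2) * H t := by
    intro t ht
    have ht' : (0 : ℝ) < t := ht
    have hcond : (ρ * r) ^ 2 * t ^ (-(2 / α)) < (ρ * r) ^ 2 ↔ 1 < t := by
      rw [mul_lt_iff_lt_one_right hm, Real.rpow_lt_one_iff_of_pos ht']
      constructor
      · rintro (h | h)
        · exact h.1
        · linarith [h.2]
      · exact fun h => Or.inl ⟨h, by linarith⟩
    have hw : θ * ρ ^ α * r ^ α * ((ρ * r) ^ 2 * t ^ (-(2 / α))) ^ (-(α / 2)) = θ * t := by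
      rw [Real.mul_rpow (by positivity) (by positivity), ← Real.rpow_mul ht'.le,
        ← Real.rpow_natCast, ← Real.rpow_mul (by positivity),
        show -(2 / α) * -(α / 2) = 1 by field_simp,
        show ((2 : ℕ) : ℝ) * -(α / 2) = -α by push_cast; ring, Real.rpow_neg (by positivity),
        Real.rpow_one, Real.mul_rpow hρ.le hr.le]
      have : r ^ α ≠ 0 := (Real.rpow_pos_of_pos hr _).ne'
      have : ρ ^ α ≠ 0 := (Real.rpow_pos_of_pos hρ _).ne'
      field_simp
    rw [hw, hH]
    have hp : 0 < t ^ (-(2 / α) - 1) := Real.rpow_pos_of_pos ht' _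
    by_cases h : 1 < t
    · simp only [hcond, h, if_true]
      rw [mul_one, mul_assoc, ENNReal.ofReal_mul hm.le]
    · simp only [hcond, h, if_false]
      rw [← ENNReal.ofReal_mul (by positivity), ← ENNReal.ofReal_mul (by positivity)]
      congr 1
      ring
  have hF : 0 ≤ θ * (2 / α) / (1 - 2 / α) * gaussHypergeometric 1 (1 - 2 / α) (2 - 2 / α) (-θ) := by
    rw [gaussHypergeometric_one_eq hδ1]
    have h1 : 0 ≤ ∫ t in (0 : ℝ)..1, t ^ (-(2 / α)) / (1 + θ * t) := by
      refine intervalIntegral.integral_nonneg zero_le_one fun t ht => ?_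
      have h2 : 0 ≤ t ^ (-(2 / α)) := Real.rpow_nonneg ht.1 _
      have h3 : 0 ≤ θ * t := mul_nonneg hθ ht.1
      positivity
    have h4 : 0 < 1 - 2 / α := by linarith
    positivity
  rw [setLIntegral_congr_fun measurableSet_Ioi hcongr, lintegral_const_mul _ hHm,
    ← Set.Ioc_union_Ioi_eq_Ioi zero_le_one, lintegral_union measurableSet_Ioi
      (Set.Ioc_disjoint_Ioi le_rfl)]
  rw [setLIntegral_congr_fun (g := fun t => ENNReal.ofReal
      (2 / α * t ^ (-(2 / α) - 1) * (θ * t / (1 + θ * t)))) measurableSet_Ioc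
      (fun t ht => by simp only [hH, not_lt.2 ht.2, if_false]),
    setLIntegral_congr_fun (g := fun t => ENNReal.ofReal
      (2 / α * t ^ (-(2 / α) - 1))) measurableSet_Ioi
      (fun t ht => by simp only [hH, Set.mem_Ioi.1 ht, if_true]),
    lintegral_Ioc_rpow_div_one_add hδ hδ1 hθ, lintegral_rpow_Ioi_one hδ, ← ENNReal.ofReal_one,
    ← ENNReal.ofReal_add hF zero_le_one, ← ENNReal.ofReal_mul hm.le,
    ← ENNReal.ofReal_mul Real.pi_pos.le]
  congr 1
  have h1 : θ * (2 / α) / (1 - 2 / α) = 2 * θ / (α - 2) := by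
    have : α - 2 ≠ 0 := by linarith
    have : 1 - 2 / α ≠ 0 := by linarith
    field_simp
  rw [h1]
  ring

theorem lintegral_plane_expNeg {A : ℝ} (hA : 0 < A) :
    ∫⁻ y : Plane, expNeg (ENNReal.ofReal (Real.pi * ‖y‖ ^ 2 * A)) = ENNReal.ofReal (1 / A) := by
  rw [lintegral_plane_norm_sq (G := fun v => expNeg (ENNReal.ofReal (Real.pi * v * A)))
    (by fun_prop), setLIntegral_congr_fun (g := fun v => ENNReal.ofReal
      (Real.exp (-((Real.pi * A) * v)))) measurableSet_Ioi, lintegral_exp_neg_mul_Ioi (by positivity),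
    ← ENNReal.ofReal_mul Real.pi_pos.le]
  · congr 1
    simp
    field_simp
  · intro v hv
    have hv' : (0 : ℝ) < v := hv
    simp only
    rw [expNeg_ofReal (by positivity)]
    ring_nf

/-! ### Exclusion radii and the decay rate of the network. -/

/-- The classes of nodes as a disjoint union. -/
def NodeClass.equivSum (K : ℕ) : NodeClass K ≃ (Fin K ⊕ Fin K) ⊕ Unit where
  toFun
    | .bs t => .inl (.inl t)
    | .user t => .inl (.inr t)
    | .jammer => .inr ()
  invFun
    | .inl (.inl t) => .bs t
    | .inl (.inr t) => .user t
    | .inr () => .jammer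
  left_inv c := by cases c <;> rfl
  right_inv c := by rcases c with (t | t) | _ <;> rfl

instance (K : ℕ) : Fintype (NodeClass K) := Fintype.ofEquiv _ (NodeClass.equivSum K).symm

instance (K : ℕ) : DecidableEq (NodeClass K) := (NodeClass.equivSum K).decidableEq

theorem NodeClass.sum_eq {K : ℕ} {M : Type*} [AddCommMonoid M] (f : NodeClass K → M) :
    ∑ c, f c = ∑ t, f (.bs t) + ∑ t, f (.user t) + f .jammer := by
  rw [← (NodeClass.equivSum K).symm.sum_comp, Fintype.sum_sum_type, Fintype.sum_sum_type]
  simp [NodeClass.equivSum]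

namespace HetNet

variable {K : ℕ} (N : HetNet K)

theorem α_pos : 0 < N.α := two_pos.trans N.two_lt_α

theorem power_pos (c : NodeClass K) : 0 < N.power c := by
  cases c
  · exact N.P_pos _
  · exact N.PU_pos
  · exact N.PJ_pos

theorem density_pos (c : NodeClass K) : 0 < N.density c := by
  cases c
  · exact N.lam_pos _
  · exact N.lam_pos _
  · exact N.lamJ_pos

/-- If the serving base station belongs to tier `k` and is at distance `r`, the nodes of class `c`
are at least at distance `N.exclusionRatio k c * r`. -/
noncomputable def exclusionRatio (k : Fin K) : NodeClass K → ℝ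
  | .bs t => (N.P t / N.P k) ^ (1 / N.α)
  | .user _ => 0
  | .jammer => 0

theorem exclusionRatio_bs_rpow (k t : Fin K) :
    N.exclusionRatio k (.bs t) ^ N.α = N.P t / N.P k := by
  have := div_pos (N.P_pos t) (N.P_pos k)
  rw [exclusionRatio, ← Real.rpow_mul this.le, one_div_mul_cancel N.α_pos.ne', Real.rpow_one]

theorem exclusionRatio_bs_pos (k t : Fin K) : 0 < N.exclusionRatio k (.bs t) :=
  Real.rpow_pos_of_pos (div_pos (N.P_pos t) (N.P_pos k)) _

theorem exclusionRatio_self (k : Fin K) : N.exclusionRatio k (.bs k) = 1 := by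
  rw [exclusionRatio, div_self (N.P_pos k).ne', Real.one_rpow]

theorem exclusionRatio_nonneg (k : Fin K) (c : NodeClass K) : 0 ≤ N.exclusionRatio k c := by
  cases c
  · exact (N.exclusionRatio_bs_pos k _).le
  · exact le_rfl
  · exact le_rfl

/-- The log-weight of a node of class `c` if the serving base station belongs to tier `k`. -/
noncomputable def classExponent (θ : ℝ) (k : Fin K) (c : NodeClass K) : ℝ≥0∞ → Plane → ℝ≥0∞ :=
  nodeExponent N.α (N.exclusionRatio k c) (θ * (N.power c / N.P k))

/-- The rate at which the probability of coverage decays with the area of the disc around the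
origin that reaches the serving base station, for unit transmit power of the latter. -/
noncomputable def decayRate (θ : ℝ) : ℝ :=
  N.Xi * (1 + 2 * θ / (N.α - 2) * gaussHypergeometric 1 (1 - 2 / N.α) (2 - 2 / N.α) (-θ)) +
    (θ * N.PU) ^ (2 / N.α) * (∑ t, N.lam t) / Real.sinc (Real.pi * (2 / N.α)) +
    (θ * N.PJ) ^ (2 / N.α) * N.lamJ / Real.sinc (Real.pi * (2 / N.α))

theorem sinc_pos : 0 < Real.sinc (Real.pi * (2 / N.α)) := by
  have h0 := N.α_pos
  have h1 : 2 / N.α < 1 := by rw [div_lt_one h0]; exact N.two_lt_α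
  rw [Real.sinc_of_ne_zero (by positivity)]
  exact div_pos (Real.sin_pos_of_pos_of_lt_pi (by positivity) (by nlinarith [Real.pi_pos]))
    (by positivity)

theorem gaussHypergeometric_nonneg {θ : ℝ} (hθ : 0 ≤ θ) :
    0 ≤ gaussHypergeometric 1 (1 - 2 / N.α) (2 - 2 / N.α) (-θ) := by
  have h1 : 2 / N.α < 1 := by rw [div_lt_one N.α_pos]; exact N.two_lt_α
  rw [gaussHypergeometric_one_eq h1]
  refine mul_nonneg (by linarith) (intervalIntegral.integral_nonneg zero_le_one fun t ht => ?_)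
  have h2 : 0 ≤ t ^ (-(2 / N.α)) := Real.rpow_nonneg ht.1 _
  have h3 : 0 ≤ θ * t := mul_nonneg hθ ht.1
  positivity

theorem Xi_pos [NeZero K] : 0 < N.Xi :=
  Finset.sum_pos (fun t _ => mul_pos (N.lam_pos t) (Real.rpow_pos_of_pos (N.P_pos t) _))
    ⟨0, Finset.mem_univ _⟩

theorem decayRate_pos [NeZero K] {θ : ℝ} (hθ : 0 ≤ θ) : 0 < N.decayRate θ := by
  have h1 := N.Xi_pos
  have h2 := N.gaussHypergeometric_nonneg hθ
  have h3 := N.sinc_pos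
  have h4 : 0 < N.α - 2 := sub_pos.2 N.two_lt_α
  have h5 : 0 ≤ ∑ t, N.lam t := Finset.sum_nonneg fun t _ => (N.lam_pos t).le
  have h6 := N.PU_pos
  have h7 := N.PJ_pos
  have h8 := N.lamJ_pos
  unfold decayRate
  positivity

theorem decayRate_zero : N.decayRate 0 = N.Xi := by
  have h : 2 / N.α ≠ 0 := (div_pos two_pos N.α_pos).ne'
  simp [decayRate, Real.zero_rpow h]

/-- Squared exclusion ratios and the powers `(θ P / P_k)^(2/α)` all contain the same factor
`P_k^(-2/α)`. The serving tier thus enters only as a scale of area, which is why the conditional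
probability does not depend on `k`. -/
theorem sum_density_mul_lintegral {θ : ℝ} (hθ : 0 ≤ θ) (k : Fin K) {r : ℝ} (hr : 0 < r) :
    ∑ c, ENNReal.ofReal (N.density c) *
        ∫⁻ z, (1 - expNeg (N.classExponent θ k c (ENNReal.ofReal r) z)) =
      ENNReal.ofReal (Real.pi * r ^ 2 * (N.decayRate θ / N.P k ^ (2 / N.α))) := by
  have hPk := N.P_pos k
  have hα := N.α_pos
  have hbs : ∀ t, ENNReal.ofReal (N.density (.bs t)) *
        ∫⁻ z, (1 - expNeg (N.classExponent θ k (.bs t) (ENNReal.ofReal r) z)) =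
      ENNReal.ofReal (N.lam t * (Real.pi * r ^ 2 * (N.exclusionRatio k (.bs t) ^ 2 *
        (1 + 2 * θ / (N.α - 2) *
          gaussHypergeometric 1 (1 - 2 / N.α) (2 - 2 / N.α) (-θ))))) := by
    intro t
    have h := lintegral_one_sub_expNeg_nodeExponent_exclusion N.two_lt_α hθ
      (N.exclusionRatio_bs_pos k t) hr
    rw [N.exclusionRatio_bs_rpow] at h
    simp only [classExponent, power, density]
    rw [h, ← ENNReal.ofReal_mul (N.lam_pos t).le]
  have hfar : ∀ c, N.exclusionRatio k c = 0 → ENNReal.ofReal (N.density c) *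
        ∫⁻ z, (1 - expNeg (N.classExponent θ k c (ENNReal.ofReal r) z)) =
      ENNReal.ofReal (N.density c * (Real.pi * r ^ 2 * ((θ * (N.power c / N.P k)) ^ (2 / N.α) /
        Real.sinc (Real.pi * (2 / N.α))))) := by
    intro c hc
    have := N.power_pos c
    simp only [classExponent, hc]
    rw [lintegral_one_sub_expNeg_nodeExponent_zero N.two_lt_α (by positivity) hr,
      ← ENNReal.ofReal_mul (N.density_pos c).le]
  have hsinc := N.sinc_pos
  have hF := N.gaussHypergeometric_nonneg hθ
  have hα2 : 0 < N.α - 2 := sub_pos.2 N.two_lt_α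
  have hlam := fun t => N.lam_pos t
  have hlJ := N.lamJ_pos
  have hPJ := N.PJ_pos
  have hPU := N.PU_pos
  have hnn : ∀ t, 0 ≤ N.lam t * (Real.pi * r ^ 2 * (N.exclusionRatio k (.bs t) ^ 2 *
        (1 + 2 * θ / (N.α - 2) *
          gaussHypergeometric 1 (1 - 2 / N.α) (2 - 2 / N.α) (-θ)))) := fun t => by
    have := hlam t
    positivity
  have hnn2 : ∀ t, 0 ≤ N.lam t * (Real.pi * r ^ 2 * ((θ * (N.PU / N.P k)) ^ (2 / N.α) /
        Real.sinc (Real.pi * (2 / N.α)))) := fun t => by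
    have := hlam t
    positivity
  rw [NodeClass.sum_eq, hfar .jammer rfl]
  simp_rw [hbs, fun t => hfar (.user t) rfl]
  simp only [power, density]
  rw [← ENNReal.ofReal_sum_of_nonneg fun t _ => hnn t,
    ← ENNReal.ofReal_sum_of_nonneg fun t _ => hnn2 t,
    ← ENNReal.ofReal_add (Finset.sum_nonneg fun t _ => hnn t) (Finset.sum_nonneg fun t _ => hnn2 t),
    ← ENNReal.ofReal_add (add_nonneg (Finset.sum_nonneg fun t _ => hnn t)
      (Finset.sum_nonneg fun t _ => hnn2 t)) (by positivity)]
  congr 1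
  have hpow : ∀ P : ℝ, 0 ≤ P → (θ * (P / N.P k)) ^ (2 / N.α) =
      (θ * P) ^ (2 / N.α) / N.P k ^ (2 / N.α) := fun P hP => by
    rw [← mul_div_assoc, Real.div_rpow (by positivity) hPk.le]
  have hratio : ∀ t, N.exclusionRatio k (.bs t) ^ 2 = N.P t ^ (2 / N.α) / N.P k ^ (2 / N.α) := by
    intro t
    have := N.P_pos t
    rw [exclusionRatio, ← Real.rpow_natCast, ← Real.rpow_mul (by positivity),
      Real.div_rpow this.le hPk.le]
    push_cast
    rw [one_div_mul_eq_div]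
  simp_rw [hratio]
  rw [hpow _ hPU.le, hpow _ hPJ.le, decayRate, Xi, add_div, add_div, mul_add, mul_add]
  congr 1
  · congr 1
    · rw [Finset.sum_mul, Finset.sum_div, Finset.mul_sum]
      refine Finset.sum_congr rfl fun t _ => ?_
      ring
    · rw [← Finset.sum_mul]
      ring
  · ring

variable {Ω : Type*} [MeasurableSpace Ω] {μ : Measure Ω} [IsProbabilityMeasure μ]
  {X : NodeClass K → ℕ → Ω → Plane} {h : NodeClass K → ℕ → Ω → ℝ}

/-- The Campbell–Mecke sum includes the serving station itself. Its exclusion ratio is `1`, so the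
strict condition does not forbid it, and as its own interferer it contributes `1 / (1 + θ)`, which
`measure_coveredBy` compensates. -/
theorem classExponent_self {θ : ℝ} (k : Fin K) {y : Plane} (hy : y ≠ 0) :
    expNeg (N.classExponent θ k (.bs k) ‖y‖ₑ y) = (1 + ENNReal.ofReal θ)⁻¹ := by
  have h0 : ‖y‖ₑ ≠ 0 := enorm_ne_zero.2 hy
  rw [classExponent, nodeExponent, exclusionRatio_self, power, div_self (N.P_pos k).ne', mul_one,
    ENNReal.ofReal_one, one_mul, tsub_self, mul_zero, zero_add, expNeg_logOneAdd, mul_assoc,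
    ← ENNReal.rpow_add _ _ h0 enorm_ne_top, add_neg_cancel, ENNReal.rpow_zero, mul_one]

theorem lintegral_tsum_classExponent [NeZero K] (hN : N.IsRealization X h μ) {θ : ℝ} (hθ : 0 ≤ θ)
    (k : Fin K) :
    ∫⁻ ω, ∑' i, expNeg (∑ c, ∑' j, N.classExponent θ k c ‖X (.bs k) i ω‖ₑ (X c j ω)) ∂μ =
      (1 + ENNReal.ofReal θ)⁻¹ *
        ENNReal.ofReal (N.lam k * N.P k ^ (2 / N.α) / N.decayRate θ) := by
  rw [lintegral_tsum_expNeg hN.ppp hN.indep_classes (g := N.classExponent θ k)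
    (fun c => measurable_nodeExponent _ _ _) (fun c y => monotone_nodeExponent N.α_pos.le _ _ y)
    (fun c y r hr => nodeExponent_iSup N.α_pos.le _ _ y hr) (.bs k)]
  have hPk : 0 < N.P k ^ (2 / N.α) := Real.rpow_pos_of_pos (N.P_pos k) _
  have hW := N.decayRate_pos hθ
  have hae : ∀ᵐ y : Plane, expNeg (N.classExponent θ k (.bs k) ‖y‖ₑ y) *
      expNeg (∑ c, ENNReal.ofReal (N.density c) *
        ∫⁻ z, (1 - expNeg (N.classExponent θ k c ‖y‖ₑ z))) =
      (1 + ENNReal.ofReal θ)⁻¹ *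
        expNeg (ENNReal.ofReal (Real.pi * ‖y‖ ^ 2 * (N.decayRate θ / N.P k ^ (2 / N.α)))) := by
    filter_upwards [compl_mem_ae_iff.2 (measure_singleton (0 : Plane))] with y hy
    rw [N.classExponent_self k hy, ← ofReal_norm,
      N.sum_density_mul_lintegral hθ k (norm_pos_iff.2 hy)]
  rw [lintegral_congr_ae hae, lintegral_const_mul _ (by fun_prop),
    lintegral_plane_expNeg (by positivity), mul_left_comm, density,
    ← ENNReal.ofReal_mul (N.lam_pos k).le]
  congr 2
  field_simp

end HetNet

/-! ### The association rule in terms of distances. -/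

namespace HetNet

variable {K : ℕ} (N : HetNet K)

theorem pathLoss_eq_enorm (y : Plane) : N.pathLoss ‖y‖ = ‖y‖ₑ ^ (-N.α) := by
  rw [pathLoss, ofReal_norm]

theorem mul_pathLoss_le_iff (k t : Fin K) {d r : ℝ} (hd : 0 ≤ d) (hr : 0 ≤ r) :
    ENNReal.ofReal (N.P t) * N.pathLoss d ≤ ENNReal.ofReal (N.P k) * N.pathLoss r ↔
      N.exclusionRatio k (.bs t) * r ≤ d := by
  have hPt := N.P_pos t
  have hPk := N.P_pos k
  -- Passing to inverses turns infinite path loss at distance `0` into the value `0`, so no distance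
  -- has to be positive.
  have h1 : ∀ s (x : ℝ), 0 ≤ x → ENNReal.ofReal (N.P s) * N.pathLoss x =
      (ENNReal.ofReal ((N.P s)⁻¹ * x ^ N.α))⁻¹ := by
    intro s x hx
    have hPs := N.P_pos s
    rw [pathLoss, ENNReal.ofReal_mul (by positivity), ENNReal.rpow_neg,
      ← ENNReal.ofReal_rpow_of_nonneg hx N.α_pos.le, ENNReal.ofReal_inv_of_pos hPs,
      ENNReal.mul_inv (Or.inr (ENNReal.rpow_ne_top_of_nonneg N.α_pos.le ENNReal.ofReal_ne_top))
        (Or.inl (by simp [hPs])), inv_inv]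
  have hρ := (N.exclusionRatio_bs_pos k t).le
  rw [h1 t d hd, h1 k r hr, ENNReal.inv_le_inv, ENNReal.ofReal_le_ofReal_iff (by positivity),
    ← Real.rpow_le_rpow_iff (mul_nonneg hρ hr) hd N.α_pos, Real.mul_rpow hρ hr,
    N.exclusionRatio_bs_rpow, inv_mul_le_iff₀ hPk, div_mul_eq_mul_div, div_le_iff₀' hPk]
  rw [mul_left_comm, le_inv_mul_iff₀ hPt]

variable {Ω : Type*} {X : NodeClass K → ℕ → Ω → Plane} {h : NodeClass K → ℕ → Ω → ℝ}

/-- The ratio for the own tier is `1`, so one family of inequalities encodes both the choice of tier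
and being nearest within it. -/
theorem isServing_iff (ω : Ω) (k : Fin K) (i : ℕ) :
    N.IsServing X ω (k, i) ↔
      ∀ t j, N.exclusionRatio k (.bs t) * ‖X (.bs k) i ω‖ ≤ ‖X (.bs t) j ω‖ := by
  have hbdd : ∀ t, BddBelow (Set.range fun j => ‖X (.bs t) j ω‖) := fun t =>
    ⟨0, by rintro _ ⟨j, rfl⟩; exact norm_nonneg _⟩
  have hnn : ∀ t, 0 ≤ nearestDist X t ω := fun t => Real.iInf_nonneg fun j => norm_nonneg _
  unfold IsServing
  simp only [N.mul_pathLoss_le_iff k _ (hnn _) (hnn _)]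
  constructor
  · rintro ⟨h1, h2⟩ t j
    rw [h2]
    exact (h1 t).trans (ciInf_le (hbdd t) j)
  · intro h1
    have h2 : ‖X (.bs k) i ω‖ = nearestDist X k ω := by
      refine le_antisymm (le_ciInf fun j => ?_) (ciInf_le (hbdd k) i)
      simpa [N.exclusionRatio_self] using h1 k j
    refine ⟨fun t => ?_, h2⟩
    rw [← h2]
    exact le_ciInf fun j => h1 t j

/-- The mean power received from a node of class `c` at location `y`. -/
noncomputable def meanPower (c : NodeClass K) (y : Plane) : ℝ≥0∞ :=
  ENNReal.ofReal (N.power c) * N.pathLoss ‖y‖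

theorem received_eq (c : NodeClass K) (i : ℕ) (ω : Ω) :
    N.received X h c i ω = N.meanPower c (X c i ω) * ENNReal.ofReal (h c i ω) := by
  rw [received, meanPower, mul_right_comm]

theorem div_meanPower_mul {θ : ℝ} (hθ : 0 ≤ θ) (k : Fin K) (c : NodeClass K) (x y : Plane) :
    ENNReal.ofReal θ / N.meanPower (.bs k) x * N.meanPower c y =
      ENNReal.ofReal (θ * (N.power c / N.P k)) * ‖x‖ₑ ^ N.α * ‖y‖ₑ ^ (-N.α) := by
  have hPk := N.P_pos k
  have hpos := N.power_pos c
  rw [meanPower, meanPower, pathLoss_eq_enorm, pathLoss_eq_enorm, power,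
    ENNReal.ofReal_mul hθ, ENNReal.ofReal_div_of_pos hPk, div_eq_mul_inv, div_eq_mul_inv,
    ENNReal.mul_inv (Or.inl (by simp [hPk])) (Or.inl ENNReal.ofReal_ne_top), ENNReal.rpow_neg ‖x‖ₑ,
    inv_inv]
  ring

/-- The locations for which the `i`-th base station of tier `k` is serving. -/
def servingLocations (k : Fin K) (i : ℕ) : Set (NodeClass K × ℕ → Plane) :=
  {x | ∀ t j, N.exclusionRatio k (.bs t) * ‖x (.bs k, i)‖ ≤ ‖x (.bs t, j)‖}

theorem measurableSet_servingLocations (k : Fin K) (i : ℕ) :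
    MeasurableSet (N.servingLocations k i) := by
  have : N.servingLocations k i = ⋂ t, ⋂ j,
      {x | N.exclusionRatio k (.bs t) * ‖x (.bs k, i)‖ ≤ ‖x (.bs t, j)‖} := by
    ext x
    simp [servingLocations]
  rw [this]
  exact MeasurableSet.iInter fun t => MeasurableSet.iInter fun j =>
    measurableSet_le (by fun_prop) (by fun_prop)

/-- The infinite parts add up to `∞` times the total violation, whose exponential is the indicator
of serving; users and jammers have ratio `0` and impose nothing. The logarithmic term of the serving
station is split off as `(1 + θ)⁻¹`. -/
theorem expNeg_sum_classExponent {θ : ℝ} (hθ : 0 ≤ θ) (k : Fin K) (i : ℕ)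
    (x : NodeClass K × ℕ → Plane) (hx : x (.bs k, i) ≠ 0) :
    expNeg (∑ c, ∑' j, N.classExponent θ k c ‖x (.bs k, i)‖ₑ (x (c, j))) =
      (1 + ENNReal.ofReal θ)⁻¹ * ((N.servingLocations k i).indicator 1 x *
        expNeg (∑' p : NodeClass K × ℕ, if p = (.bs k, i) then 0 else
          logOneAdd (ENNReal.ofReal θ / N.meanPower (.bs k) (x (.bs k, i)) *
            N.meanPower p.1 (x p)))) := by
  set r := ‖x (.bs k, i)‖ₑ with hr
  have h0 : r ≠ 0 := enorm_ne_zero.2 hx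
  have h1 : ∑ c, ∑' j, N.classExponent θ k c r (x (c, j)) =
      ∞ * (∑' p : NodeClass K × ℕ, (ENNReal.ofReal (N.exclusionRatio k p.1) * r - ‖x p‖ₑ)) +
      ∑' p : NodeClass K × ℕ, logOneAdd (ENNReal.ofReal θ / N.meanPower (.bs k) (x (.bs k, i)) *
            N.meanPower p.1 (x p)) := by
    rw [← tsum_fintype (L := .unconditional _), ← ENNReal.tsum_mul_left, ← ENNReal.tsum_add,
      ← ENNReal.tsum_prod (f := fun c j => N.classExponent θ k c r (x (c, j)))]
    refine tsum_congr fun p => ?_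
    rw [N.div_meanPower_mul hθ k p.1]
    rfl
  have h2 : (∑' p : NodeClass K × ℕ, (ENNReal.ofReal (N.exclusionRatio k p.1) * r - ‖x p‖ₑ)) = 0 ↔
      x ∈ N.servingLocations k i := by
    rw [ENNReal.tsum_eq_zero]
    simp only [tsub_eq_zero_iff_le, servingLocations, Set.mem_ofPred_eq]
    have h3 : ∀ p : NodeClass K × ℕ, ENNReal.ofReal (N.exclusionRatio k p.1) * r ≤ ‖x p‖ₑ ↔
        N.exclusionRatio k p.1 * ‖x (.bs k, i)‖ ≤ ‖x p‖ := by
      intro p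
      rw [hr, ← ofReal_norm, ← ofReal_norm, ← ENNReal.ofReal_mul (N.exclusionRatio_nonneg k _),
        ENNReal.ofReal_le_ofReal_iff (norm_nonneg _)]
    simp only [h3]
    constructor
    · exact fun H t j => H (.bs t, j)
    · rintro H ⟨t | t | _, j⟩
      · exact H t j
      · simp [exclusionRatio]
      · simp [exclusionRatio]
  rw [h1, expNeg_add, expNeg_top_mul, ENNReal.tsum_eq_add_tsum_ite (f := fun p : NodeClass K × ℕ =>
      logOneAdd (ENNReal.ofReal θ / N.meanPower (.bs k) (x (.bs k, i)) * N.meanPower p.1 (x p)))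
      (NodeClass.bs k, i), expNeg_add, expNeg_logOneAdd, N.div_meanPower_mul hθ k]
  have h4 : ENNReal.ofReal (θ * (N.power (.bs k) / N.P k)) * ‖x (.bs k, i)‖ₑ ^ N.α *
      ‖x (.bs k, i)‖ₑ ^ (-N.α) = ENNReal.ofReal θ := by
    rw [power, div_self (N.P_pos k).ne', mul_one, mul_assoc,
      ← ENNReal.rpow_add _ _ h0 enorm_ne_top, add_neg_cancel, ENNReal.rpow_zero, mul_one]
  rw [h4]
  by_cases hA : x ∈ N.servingLocations k i
  · rw [if_pos (h2.2 hA), Set.indicator_of_mem hA, one_mul, Pi.one_apply, one_mul]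
    congr!
  · rw [if_neg (fun H => hA (h2.1 H)), Set.indicator_of_notMem hA]
    simp

variable [MeasurableSpace Ω] {μ : Measure Ω}

/-- By Campbell's formula the expected number of points in `A` is zero. -/
theorem _root_.IsHomogeneousPPP.ae_forall_notMem [IsProbabilityMeasure μ] {x : ℕ → Ω → Plane}
    {lam : ℝ} (hx : IsHomogeneousPPP x lam μ) {A : Set Plane} (hA : MeasurableSet A)
    (h0 : volume A = 0) : ∀ᵐ ω ∂μ, ∀ i, x i ω ∉ A := by
  have hm : Measurable (A.indicator (1 : Plane → ℝ≥0∞)) := measurable_one.indicator hA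
  have h1 := hx.lintegral_tsum hm
  rw [lintegral_indicator_one hA, h0, mul_zero, lintegral_eq_zero_iff (hx.measurable_tsum hm)] at h1
  filter_upwards [h1] with ω hω i hi
  have := ENNReal.tsum_eq_zero.1 hω i
  rw [Set.indicator_of_mem hi] at this
  simp at this

theorem _root_.IsHomogeneousPPP.ae_finite_ball [IsProbabilityMeasure μ] {x : ℕ → Ω → Plane}
    {lam : ℝ} (hx : IsHomogeneousPPP x lam μ) :
    ∀ᵐ ω ∂μ, ∀ n : ℕ, {i | ‖x i ω‖ < n}.Finite := by
  rw [ae_all_iff]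
  intro n
  have hA : MeasurableSet (Metric.ball (0 : Plane) n) := measurableSet_ball
  have hm : Measurable ((Metric.ball (0 : Plane) n).indicator (1 : Plane → ℝ≥0∞)) :=
    measurable_one.indicator hA
  have h1 := hx.lintegral_tsum hm
  rw [lintegral_indicator_one hA] at h1
  have h2 := ae_lt_top (hx.measurable_tsum hm)
    (h1 ▸ ENNReal.mul_ne_top ENNReal.ofReal_ne_top measure_ball_lt_top.ne)
  filter_upwards [h2] with ω hω
  refine (ENNReal.finite_const_le_of_tsum_ne_top hω.ne one_ne_zero).subset fun i hi => ?_
  have : x i ω ∈ Metric.ball (0 : Plane) n := by simpa using hi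
  simp only [Set.mem_ofPred_eq]
  rw [Set.indicator_of_mem this]
  rfl

end HetNet

/-! ### Probabilities of serving and covering; uniqueness of the serving station. -/

namespace HetNet

variable {K : ℕ} (N : HetNet K) {Ω : Type*} [MeasurableSpace Ω] {μ : Measure Ω}
  [IsProbabilityMeasure μ] {X : NodeClass K → ℕ → Ω → Plane} {h : NodeClass K → ℕ → Ω → ℝ}

instance : Countable (NodeClass K) := Finite.to_countable

variable (X h) in
/-- The event that the `i`-th base station of tier `k` is serving and the signal received from it
has at least `θ` times the power of all other signals together. -/
def coveredBy (θ : ℝ) (k : Fin K) (i : ℕ) : Set Ω :=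
  {ω | N.IsServing X ω (k, i) ∧ ENNReal.ofReal θ ≤ N.received X h (.bs k) i ω /
    ∑' p : NodeClass K × ℕ, if p = (.bs k, i) then 0 else N.received X h p.1 p.2 ω}

omit [MeasurableSpace Ω] in
theorem isServing_iff_mem (ω : Ω) (k : Fin K) (i : ℕ) :
    N.IsServing X ω (k, i) ↔ (fun p : NodeClass K × ℕ => X p.1 p.2 ω) ∈ N.servingLocations k i :=
  N.isServing_iff ω k i

namespace IsRealization

variable {N} (hN : N.IsRealization X h μ)
include hN

omit [IsProbabilityMeasure μ] in
theorem measurable_locations : Measurable fun ω (p : NodeClass K × ℕ) => X p.1 p.2 ω :=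
  measurable_pi_lambda _ fun p => (hN.ppp p.1).measurable p.2

omit [IsProbabilityMeasure μ] in
theorem measurableSet_isServing (k : Fin K) (i : ℕ) :
    MeasurableSet {ω | N.IsServing X ω (k, i)} := by
  simp only [N.isServing_iff_mem]
  exact hN.measurable_locations (N.measurableSet_servingLocations k i)

omit [IsProbabilityMeasure μ] in
theorem measurable_received (c : NodeClass K) (i : ℕ) :
    Measurable (N.received X h c i) := by
  have h1 := (hN.ppp c).measurable i
  have h2 := hN.fading_measurable c i
  unfold received pathLoss
  fun_prop

omit [IsProbabilityMeasure μ] in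
theorem measurableSet_coveredBy (θ : ℝ) (k : Fin K) (i : ℕ) :
    MeasurableSet (N.coveredBy X h θ k i) := by
  refine (hN.measurableSet_isServing k i).inter (s₂ := {ω | ENNReal.ofReal θ ≤
    N.received X h (.bs k) i ω / ∑' p : NodeClass K × ℕ,
      if p = (.bs k, i) then 0 else N.received X h p.1 p.2 ω}) (measurableSet_le measurable_const ?_)
  refine (hN.measurable_received _ _).div (Measurable.tsum fun p => ?_)
  split_ifs
  · exact measurable_const
  · exact hN.measurable_received _ _

theorem ae_ne_zero : ∀ᵐ ω ∂μ, ∀ c i, X c i ω ≠ 0 := by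
  rw [ae_all_iff]
  exact fun c => (hN.ppp c).ae_forall_notMem (measurableSet_singleton 0) (measure_singleton 0)

/-- Locations and gains are independent: with the locations frozen, `measure_coverage_fading` gives
the coverage probability, and `expNeg_sum_classExponent` identifies it, together with the serving
indicator, as one exponential up to `1 + θ`. -/
theorem measure_coveredBy {θ : ℝ} (hθ : 0 ≤ θ) (k : Fin K) (i : ℕ) :
    μ (N.coveredBy X h θ k i) = (1 + ENNReal.ofReal θ) *
      ∫⁻ ω, expNeg (∑ c, ∑' j, N.classExponent θ k c ‖X (.bs k) i ω‖ₑ (X c j ω)) ∂μ := by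
  have hPk := N.P_pos k
  set D : Set ((NodeClass K × ℕ → Plane) × (NodeClass K × ℕ → ℝ)) :=
    {q | q.1 ∈ N.servingLocations k i ∧ ENNReal.ofReal θ ≤
      N.meanPower (.bs k) (q.1 (.bs k, i)) * ENNReal.ofReal (q.2 (.bs k, i)) /
        ∑' p : NodeClass K × ℕ, if p = (.bs k, i) then 0 else
          N.meanPower p.1 (q.1 p) * ENNReal.ofReal (q.2 p)} with hD
  have hmp : ∀ c, Measurable (N.meanPower c) := fun c => by
    unfold meanPower pathLoss
    fun_prop
  have hrec : ∀ p : NodeClass K × ℕ, Measurable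
      fun q : (NodeClass K × ℕ → Plane) × (NodeClass K × ℕ → ℝ) =>
        N.meanPower p.1 (q.1 p) * ENNReal.ofReal (q.2 p) := fun p =>
    ((hmp p.1).comp ((measurable_pi_apply p).comp measurable_fst)).mul
      (ENNReal.measurable_ofReal.comp ((measurable_pi_apply p).comp measurable_snd))
  have hDm : MeasurableSet D := by
    refine (measurable_fst (N.measurableSet_servingLocations k i)).inter
      (measurableSet_le measurable_const ((hrec (.bs k, i)).div (Measurable.tsum fun p => ?_)))
    split_ifs
    · exact measurable_const
    · exact hrec p
  have hfm : Measurable fun ω (p : NodeClass K × ℕ) => h p.1 p.2 ω :=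
    measurable_pi_lambda _ fun p => hN.fading_measurable p.1 p.2
  have hcov : ∀ ω, (N.coveredBy X h θ k i).indicator (1 : Ω → ℝ≥0∞) ω =
      D.indicator 1 (fun p => X p.1 p.2 ω, fun p => h p.1 p.2 ω) := by
    intro ω
    have : ω ∈ N.coveredBy X h θ k i ↔ (fun p => X p.1 p.2 ω, fun p => h p.1 p.2 ω) ∈ D := by
      simp only [coveredBy, hD, Set.mem_ofPred_eq, N.isServing_iff_mem, received_eq]
    by_cases hd : (fun p => X p.1 p.2 ω, fun p => h p.1 p.2 ω) ∈ D
    · rw [Set.indicator_of_mem hd, Set.indicator_of_mem (this.2 hd)]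
      rfl
    · rw [Set.indicator_of_notMem hd, Set.indicator_of_notMem (fun H => hd (this.1 H))]
  rw [← lintegral_indicator_one (hN.measurableSet_coveredBy θ k i)]
  simp_rw [hcov]
  rw [lintegral_indepFun (F := D.indicator 1) hN.fading_indep_locations hN.measurable_locations hfm
    (measurable_one.indicator hDm), ← lintegral_const_mul']
  swap
  · simp
  refine lintegral_congr_ae ?_
  filter_upwards [hN.ae_ne_zero] with ω hω
  set x : NodeClass K × ℕ → Plane := fun p => X p.1 p.2 ω with hx
  have hx0 : x (.bs k, i) ≠ 0 := hω _ _
  have hmain := N.expNeg_sum_classExponent hθ k i x hx0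
  rw [show ∑ c, ∑' j, N.classExponent θ k c ‖X (.bs k) i ω‖ₑ (X c j ω) =
      ∑ c, ∑' j, N.classExponent θ k c ‖x (.bs k, i)‖ₑ (x (c, j)) from rfl, hmain, ← mul_assoc,
    ENNReal.mul_inv_cancel (by simp) (by simp), one_mul]
  have h0 : ‖x (.bs k, i)‖ₑ ≠ 0 := enorm_ne_zero.2 hx0
  have hb0 : N.meanPower (.bs k) (x (.bs k, i)) ≠ 0 := by
    rw [meanPower, pathLoss_eq_enorm]
    refine mul_ne_zero (by simp [power, hPk]) ?_
    exact (ENNReal.rpow_pos (pos_iff_ne_zero.2 h0) enorm_ne_top).ne'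
  have hbt : N.meanPower (.bs k) (x (.bs k, i)) ≠ ∞ := by
    rw [meanPower, pathLoss_eq_enorm]
    exact ENNReal.mul_ne_top ENNReal.ofReal_ne_top (ENNReal.rpow_ne_top_of_ne_zero h0 enorm_ne_top)
  have hfad := measure_coverage_fading (μ := μ) (h := fun (p : NodeClass K × ℕ) ω => h p.1 p.2 ω)
    (fun p => hN.fading_measurable p.1 p.2) (fun p => hN.fading_law p.1 p.2) hN.fading_indep
    (.bs k, i) (fun p => N.meanPower p.1 (x p)) (t := ENNReal.ofReal θ) hb0 hbt
  rw [← hfad]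
  have hsec : MeasurableSet {ω' | (x, fun p : NodeClass K × ℕ => h p.1 p.2 ω') ∈ D} :=
    (measurable_const.prodMk hfm) hDm
  by_cases hA : x ∈ N.servingLocations k i
  · rw [Set.indicator_of_mem hA, Pi.one_apply, one_mul]
    refine (lintegral_indicator_one hsec).trans ?_
    congr 1
    ext ω'
    simp only [hD, Set.mem_ofPred_eq, hA, true_and]
  · rw [Set.indicator_of_notMem hA, zero_mul]
    refine (lintegral_congr fun ω' => ?_).trans lintegral_zero
    exact Set.indicator_of_notMem (fun H => hA H.1) _

theorem tsum_measure_coveredBy [NeZero K] {θ : ℝ} (hθ : 0 ≤ θ) (k : Fin K) :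
    ∑' i, μ (N.coveredBy X h θ k i) =
      ENNReal.ofReal (N.lam k * N.P k ^ (2 / N.α) / N.decayRate θ) := by
  simp_rw [hN.measure_coveredBy hθ k]
  have hm : ∀ c i, Measurable fun ω =>
      ∑' j, N.classExponent θ k c ‖X (.bs k) i ω‖ₑ (X c j ω) := fun c i =>
    Measurable.tsum fun j => (measurable_nodeExponent _ _ _).comp
      (((hN.ppp (.bs k)).measurable i).enorm.prodMk ((hN.ppp c).measurable j))
  rw [ENNReal.tsum_mul_left, ← lintegral_tsum fun i => ?_, N.lintegral_tsum_classExponent hN hθ k,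
    ← mul_assoc, ENNReal.mul_inv_cancel (by simp) (by simp), one_mul]
  have := fun c => hm c i
  exact Measurable.aemeasurable (by fun_prop)

/-- At `θ = 0` the coverage condition is void. -/
theorem tsum_measure_isServing [NeZero K] (k : Fin K) :
    ∑' i, μ {ω | N.IsServing X ω (k, i)} =
      ENNReal.ofReal (N.lam k * N.P k ^ (2 / N.α) / N.Xi) := by
  rw [← N.decayRate_zero, ← hN.tsum_measure_coveredBy le_rfl k]
  refine tsum_congr fun i => ?_
  congr 1
  ext ω
  simp [coveredBy]

/-- A serving station minimizes `‖x‖ / P_t^(1/α)`. By local finiteness only finitely many stations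
do at least as well as the reference station `(0, 0)`, so a minimum exists. -/
theorem ae_exists_isServing [NeZero K] : ∀ᵐ ω ∂μ, ∃ b, N.IsServing X ω b := by
  have hfin : ∀ᵐ ω ∂μ, ∀ t : Fin K, ∀ n : ℕ, {j | ‖X (.bs t) j ω‖ < n}.Finite := by
    rw [ae_all_iff]
    exact fun t => (hN.ppp (.bs t)).ae_finite_ball
  filter_upwards [hfin] with ω hω
  have hP : ∀ t, 0 < N.P t ^ (1 / N.α) := fun t => Real.rpow_pos_of_pos (N.P_pos t) _
  let q : Fin K × ℕ → ℝ := fun b => ‖X (.bs b.1) b.2 ω‖ / N.P b.1 ^ (1 / N.α)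
  have hS : {b | q b ≤ q (0, 0)}.Finite := by
    have hsub : {b | q b ≤ q (0, 0)} ⊆ ⋃ t, (Prod.mk t) ''
        {j | ‖X (.bs t) j ω‖ < ((⌊q (0, 0) * N.P t ^ (1 / N.α)⌋₊ + 1 : ℕ) : ℝ)} := by
      rintro ⟨t, j⟩ hb
      refine Set.mem_iUnion.2 ⟨t, j, ?_, rfl⟩
      have hb' : ‖X (.bs t) j ω‖ / N.P t ^ (1 / N.α) ≤ q (0, 0) := hb
      rw [div_le_iff₀ (hP t)] at hb'
      refine hb'.trans_lt ?_
      push_cast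
      exact Nat.lt_floor_add_one _
    exact (Set.finite_iUnion fun t => (hω t _).image _).subset hsub
  obtain ⟨⟨k, i⟩, hb, hmin⟩ := Set.exists_min_image _ q hS ⟨(0, 0), le_refl (q (0, 0))⟩
  refine ⟨(k, i), (N.isServing_iff ω k i).2 fun t j => ?_⟩
  have hle : q (k, i) ≤ q (t, j) := by
    by_cases hm : q (t, j) ≤ q (0, 0)
    · exact hmin _ hm
    · exact le_trans hb (not_le.1 hm).le
  have hle' : ‖X (.bs k) i ω‖ / N.P k ^ (1 / N.α) ≤ ‖X (.bs t) j ω‖ / N.P t ^ (1 / N.α) := hle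
  rw [le_div_iff₀ (hP t)] at hle'
  rw [exclusionRatio, Real.div_rpow (N.P_pos t).le (N.P_pos k).le]
  calc _ = ‖X (.bs k) i ω‖ / N.P k ^ (1 / N.α) * N.P t ^ (1 / N.α) := by ring
    _ ≤ _ := hle'

/-- The number of serving stations is almost surely at least `1` and has mean `∑ λ_k P_k^(2/α) / Ξ =
1`, hence equals `1` almost surely. Ties between distances need no analysis. -/
theorem ae_existsUnique_isServing [NeZero K] : ∀ᵐ ω ∂μ, ∃! b, N.IsServing X ω b := by
  let S : Fin K × ℕ → Set Ω := fun b => {ω | N.IsServing X ω b}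
  have hS : ∀ b, MeasurableSet (S b) := fun b => hN.measurableSet_isServing b.1 b.2
  have hSm : ∀ b, Measurable ((S b).indicator (1 : Ω → ℝ≥0∞)) := fun b =>
    measurable_one.indicator (hS b)
  have hMm : Measurable fun ω => ∑' b, (S b).indicator (1 : Ω → ℝ≥0∞) ω := Measurable.tsum hSm
  have hone : ∫⁻ ω, ∑' b, (S b).indicator (1 : Ω → ℝ≥0∞) ω ∂μ = 1 := by
    have hX := N.Xi_pos
    have h2 : ∀ k, 0 ≤ N.lam k * N.P k ^ (2 / N.α) / N.Xi := fun k => by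
      have := N.lam_pos k
      have := N.P_pos k
      positivity
    rw [lintegral_tsum fun b => (hSm b).aemeasurable]
    simp_rw [fun b => lintegral_indicator_one (μ := μ) (hS b)]
    rw [ENNReal.tsum_prod (f := fun k i => μ (S (k, i))), tsum_fintype]
    simp only [S]
    simp_rw [hN.tsum_measure_isServing]
    rw [← ENNReal.ofReal_sum_of_nonneg fun k _ => h2 k, ← Finset.sum_div]
    rw [show ∑ k, N.lam k * N.P k ^ (2 / N.α) = N.Xi from rfl, div_self hX.ne', ENNReal.ofReal_one]
  have hge : (fun _ => 1) ≤ᵐ[μ] fun ω => ∑' b, (S b).indicator (1 : Ω → ℝ≥0∞) ω := by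
    filter_upwards [hN.ae_exists_isServing] with ω ⟨b, hb⟩
    refine le_trans ?_ (ENNReal.le_tsum b)
    rw [Set.indicator_of_mem (show ω ∈ S b from hb)]
    rfl
  have heq := ae_eq_of_ae_le_of_lintegral_le hge (by simp) hMm.aemeasurable (by simp [hone])
  filter_upwards [heq, hN.ae_exists_isServing] with ω h1 ⟨b, hb⟩
  refine ⟨b, hb, fun b' hb' => ?_⟩
  by_contra hne
  have h2 : (2 : ℝ≥0∞) ≤ ∑' b, (S b).indicator (1 : Ω → ℝ≥0∞) ω := by
    refine le_trans ?_ (ENNReal.sum_le_tsum {b, b'})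
    rw [Finset.sum_pair (Ne.symm hne),
      Set.indicator_of_mem (show ω ∈ S b from hb),
      Set.indicator_of_mem (show ω ∈ S b' from hb')]
    simp only [Pi.one_apply]
    norm_num
  rw [← h1] at h2
  norm_num at h2

/-- Path loss is infinite at distance `0` and the threshold is strict, so even for `τ = ∞` a jammer
must avoid the origin and all users. It does so almost surely, since a PPP avoids fixed points and
the classes are independent. -/
theorem ae_jammerActive : ∀ᵐ ω ∂μ, ∀ j, N.JammerActive X ∞ ω j := by
  have hd : ∀ᵐ ω ∂μ, ∀ t j i, X .jammer j ω ≠ X (.user t) i ω := by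
    rw [ae_all_iff]
    intro t
    rw [ae_all_iff]
    intro j
    rw [ae_all_iff]
    intro i
    have hmJ := (hN.ppp .jammer).measurable j
    have hmU := (hN.ppp (.user t)).measurable i
    have hind : IndepFun (X (.user t) i) (X .jammer j) μ :=
      (hN.indep_classes.indepFun (i := .user t) (j := .jammer) (by simp)).comp
        (φ := fun z : ℕ → Plane => z i) (ψ := fun z : ℕ → Plane => z j)
        (measurable_pi_apply i) (measurable_pi_apply j)
    have hdiag : MeasurableSet {p : Plane × Plane | p.2 = p.1} :=
      measurableSet_eq_fun measurable_snd measurable_fst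
    have h1 := lintegral_indepFun hind hmU hmJ (F := {p : Plane × Plane | p.2 = p.1}.indicator 1)
      (measurable_one.indicator hdiag)
    have h2 : ∀ y : Plane, ∫⁻ ω, {p : Plane × Plane | p.2 = p.1}.indicator 1 (y, X .jammer j ω) ∂μ
        = 0 := by
      intro y
      have hm : Measurable fun ω => {p : Plane × Plane | p.2 = p.1}.indicator (1 : Plane × Plane → ℝ≥0∞)
          (y, X .jammer j ω) :=
        (measurable_one.indicator hdiag).comp (measurable_const.prodMk hmJ)
      rw [lintegral_eq_zero_iff hm]
      filter_upwards [(hN.ppp .jammer).ae_forall_notMem (measurableSet_singleton y)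
        (measure_singleton y)] with ω hω
      have hn : (y, X .jammer j ω) ∉ {p : Plane × Plane | p.2 = p.1} := fun H => hω j H
      exact Set.indicator_of_notMem hn (1 : Plane × Plane → ℝ≥0∞)
    simp_rw [h2] at h1
    have hm : Measurable fun ω => {p : Plane × Plane | p.2 = p.1}.indicator (1 : Plane × Plane → ℝ≥0∞)
        (X (.user t) i ω, X .jammer j ω) :=
      (measurable_one.indicator hdiag).comp (hmU.prodMk hmJ)
    rw [lintegral_zero, lintegral_eq_zero_iff hm] at h1
    filter_upwards [h1] with ω hω heq
    rw [Set.indicator_of_mem (show (X (.user t) i ω, X .jammer j ω) ∈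
      {p : Plane × Plane | p.2 = p.1} from heq)] at hω
    simp at hω
  have hlt : ∀ d : ℝ, 0 < d → ENNReal.ofReal N.PJ * N.pathLoss d < ∞ := fun d hd =>
    ENNReal.mul_lt_top ENNReal.ofReal_lt_top
      (lt_top_iff_ne_top.2 (ENNReal.rpow_ne_top_of_ne_zero (by simpa using hd)
        ENNReal.ofReal_ne_top))
  filter_upwards [hd, hN.ae_ne_zero] with ω h1 h2 j
  exact ⟨hlt _ (norm_pos_iff.2 (h2 _ _)), fun t i => hlt _ (dist_pos.2 (h1 t j i))⟩

end IsRealization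

omit [MeasurableSpace Ω] in
theorem sinr_eq [NeZero K] {ω : Ω} {k : Fin K} {i : ℕ} (hs : N.servingBS X ω = (k, i))
    (hJ : ∀ j, N.JammerActive X ∞ ω j) :
    N.sinr X h ∞ 0 0 ω = N.received X h (.bs k) i ω /
      ∑' p : NodeClass K × ℕ, if p = (.bs k, i) then 0 else N.received X h p.1 p.2 ω := by
  rw [sinr, hs, add_zero, add_zero]
  congr 1
  rw [ENNReal.tsum_prod (f := fun c j => if (c, j) = (NodeClass.bs k, i) then 0 else
    N.received X h c j ω), tsum_fintype, NodeClass.sum_eq, interferenceBS, interferenceUser,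
    interferenceJammer, hs]
  congr 1
  · congr 1
    refine Finset.sum_congr rfl fun t _ => tsum_congr fun j => ?_
    simp
  · refine tsum_congr fun j => ?_
    simp [hJ j]

end HetNet

/-! ### Connection probabilities. -/

namespace HetNet

variable {K : ℕ} {N : HetNet K} {Ω : Type*} [MeasurableSpace Ω] {μ : Measure Ω}
  [IsProbabilityMeasure μ] {X : NodeClass K → ℕ → Ω → Plane} {h : NodeClass K → ℕ → Ω → ℝ}

namespace IsRealization

variable [NeZero K] (hN : N.IsRealization X h μ)
include hN

theorem ae_servingBS_eq_iff : ∀ᵐ ω ∂μ, ∀ b, N.servingBS X ω = b ↔ N.IsServing X ω b := by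
  filter_upwards [hN.ae_existsUnique_isServing] with ω ⟨b, hb, huniq⟩ b'
  have hs : N.IsServing X ω (N.servingBS X ω) := Classical.epsilon_spec ⟨b, hb⟩
  constructor
  · rintro rfl
    exact hs
  · intro hb'
    rw [huniq _ hb', huniq _ hs]

theorem servedBy_ae_eq (k : Fin K) :
    N.servedBy X k =ᵐ[μ] ⋃ i, {ω | N.IsServing X ω (k, i)} := by
  filter_upwards [hN.ae_servingBS_eq_iff] with ω hω
  refine propext ?_
  change (N.servingBS X ω).1 = k ↔ ω ∈ ⋃ i, {ω | N.IsServing X ω (k, i)}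
  simp only [Set.mem_iUnion, Set.mem_ofPred_eq, ← hω]
  constructor
  · rintro rfl
    exact ⟨(N.servingBS X ω).2, rfl⟩
  · rintro ⟨i, hi⟩
    rw [hi]

theorem connected_inter_servedBy_ae_eq (θ : ℝ) (k : Fin K) :
    (N.connected X h ∞ 0 0 θ ∩ N.servedBy X k : Set Ω) =ᵐ[μ] ⋃ i, N.coveredBy X h θ k i := by
  filter_upwards [hN.ae_servingBS_eq_iff, hN.ae_jammerActive] with ω hω hJ
  refine propext ?_
  change (ENNReal.ofReal θ ≤ N.sinr X h ∞ 0 0 ω ∧ (N.servingBS X ω).1 = k) ↔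
    ω ∈ ⋃ i, N.coveredBy X h θ k i
  simp only [Set.mem_iUnion, coveredBy, Set.mem_ofPred_eq]
  constructor
  · rintro ⟨h1, rfl⟩
    refine ⟨(N.servingBS X ω).2, (hω _).1 rfl, ?_⟩
    rwa [N.sinr_eq (k := (N.servingBS X ω).1) (i := (N.servingBS X ω).2) rfl hJ] at h1
  · rintro ⟨i, h1, h2⟩
    have hs := (hω _).2 h1
    rw [N.sinr_eq hs hJ, hs]
    exact ⟨h2, rfl⟩

theorem aedisjoint_isServing (k : Fin K) :
    Pairwise (Function.onFun (AEDisjoint μ) fun i => {ω | N.IsServing X ω (k, i)}) := by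
  intro i j hij
  refine measure_mono_null (t := {ω | ¬ ∃! b, N.IsServing X ω b}) ?_ hN.ae_existsUnique_isServing
  rintro ω ⟨h1, h2⟩ hu
  exact hij (congrArg Prod.snd (hu.unique h1 h2))

/-- The serving station is picked by `Classical.epsilon`, so measurability is derived from an almost
sure description. -/
theorem nullMeasurableSet_servedBy (k : Fin K) : NullMeasurableSet (N.servedBy X k) μ :=
  (MeasurableSet.iUnion fun i => hN.measurableSet_isServing k i).nullMeasurableSet.congr
    (hN.servedBy_ae_eq k).symm

theorem measure_servedBy (k : Fin K) :
    μ (N.servedBy X k) = ENNReal.ofReal (N.lam k * N.P k ^ (2 / N.α) / N.Xi) := by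
  rw [measure_congr (hN.servedBy_ae_eq k), measure_iUnion₀ (hN.aedisjoint_isServing k)
    fun i => (hN.measurableSet_isServing k i).nullMeasurableSet, hN.tsum_measure_isServing]

theorem nullMeasurableSet_connected_inter_servedBy (θ : ℝ) (k : Fin K) :
    NullMeasurableSet (N.connected X h ∞ 0 0 θ ∩ N.servedBy X k) μ :=
  (MeasurableSet.iUnion fun i => hN.measurableSet_coveredBy θ k i).nullMeasurableSet.congr
    (hN.connected_inter_servedBy_ae_eq θ k).symm

theorem measure_connected_inter_servedBy {θ : ℝ} (hθ : 0 ≤ θ) (k : Fin K) :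
    μ (N.connected X h ∞ 0 0 θ ∩ N.servedBy X k) =
      ENNReal.ofReal (N.lam k * N.P k ^ (2 / N.α) / N.decayRate θ) := by
  rw [measure_congr (hN.connected_inter_servedBy_ae_eq θ k), measure_iUnion₀ ?_
    fun i => (hN.measurableSet_coveredBy θ k i).nullMeasurableSet, hN.tsum_measure_coveredBy hθ]
  exact fun i j hij => (hN.aedisjoint_isServing k hij).mono (fun ω hω => hω.1) fun ω hω => hω.1

theorem measure_connected {θ : ℝ} (hθ : 0 ≤ θ) :
    μ (N.connected X h ∞ 0 0 θ) = ENNReal.ofReal (N.Xi / N.decayRate θ) := by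
  have hunion : N.connected X h ∞ 0 0 θ = ⋃ k, N.connected X h ∞ 0 0 θ ∩ N.servedBy X k := by
    ext ω
    simp [servedBy]
  rw [hunion, measure_iUnion₀ ?_ fun k => hN.nullMeasurableSet_connected_inter_servedBy θ k,
    tsum_fintype]
  · simp_rw [hN.measure_connected_inter_servedBy hθ]
    have hW := N.decayRate_pos hθ
    rw [← ENNReal.ofReal_sum_of_nonneg fun k _ => ?_, ← Finset.sum_div]
    · rfl
    · have := N.lam_pos k
      have := N.P_pos k
      positivity
  · intro k l hkl
    refine Disjoint.aedisjoint (Set.disjoint_left.2 fun ω h1 h2 => hkl ?_)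
    exact (show (N.servingBS X ω).1 = k from h1.2).symm.trans h2.2

/-- Joint and marginal probabilities share the factor `λ_k P_k^(2/α)`, which cancels. -/
theorem cond_connected {θ : ℝ} (hθ : 0 ≤ θ) (k : Fin K) :
    ProbabilityTheory.cond μ (N.servedBy X k) (N.connected X h ∞ 0 0 θ) =
      ENNReal.ofReal (N.Xi / N.decayRate θ) := by
  have hX := N.Xi_pos
  have hW := N.decayRate_pos hθ
  have hl := N.lam_pos k
  have hP : 0 < N.P k ^ (2 / N.α) := Real.rpow_pos_of_pos (N.P_pos k) _
  rw [ProbabilityTheory.cond, Measure.smul_apply,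
    Measure.restrict_apply₀' (hN.nullMeasurableSet_servedBy k),
    hN.measure_servedBy, hN.measure_connected_inter_servedBy hθ, smul_eq_mul,
    ← ENNReal.ofReal_inv_of_pos (by positivity), ← ENNReal.ofReal_mul (by positivity)]
  congr 1
  field_simp

end IsRealization

-- The four exponents add up to `-π v` times the decay rate, leaving one exponential integral.
variable (N) in
theorem integral_exp_eq_div_decayRate [NeZero K] {θ : ℝ} (hθ : 0 ≤ θ) :
    (Real.pi * N.Xi * ∫ v in Set.Ioi (0 : ℝ),
      Real.exp (-(2 * Real.pi * v * θ * N.Xi / (N.α - 2) *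
          gaussHypergeometric 1 (1 - 2 / N.α) (2 - 2 / N.α) (-θ))) *
        Real.exp (-(Real.pi * v * (θ * N.PU) ^ (2 / N.α) * ∑ t, N.lam t) /
          Real.sinc (Real.pi * (2 / N.α))) *
        Real.exp (-(Real.pi * v * (θ * N.PJ) ^ (2 / N.α) * N.lamJ) /
          Real.sinc (Real.pi * (2 / N.α))) *
        Real.exp (-(Real.pi * v * N.Xi))) = N.Xi / N.decayRate θ := by
  have hW := N.decayRate_pos hθ
  have hint : ∀ v : ℝ, Real.exp (-(2 * Real.pi * v * θ * N.Xi / (N.α - 2) *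
          gaussHypergeometric 1 (1 - 2 / N.α) (2 - 2 / N.α) (-θ))) *
        Real.exp (-(Real.pi * v * (θ * N.PU) ^ (2 / N.α) * ∑ t, N.lam t) /
          Real.sinc (Real.pi * (2 / N.α))) *
        Real.exp (-(Real.pi * v * (θ * N.PJ) ^ (2 / N.α) * N.lamJ) /
          Real.sinc (Real.pi * (2 / N.α))) *
        Real.exp (-(Real.pi * v * N.Xi)) = Real.exp (-(Real.pi * N.decayRate θ) * v) := by
    intro v
    rw [← Real.exp_add, ← Real.exp_add, ← Real.exp_add, decayRate]
    congr 1
    ring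
  have hneg : -(Real.pi * N.decayRate θ) < 0 := neg_lt_zero.2 (mul_pos Real.pi_pos hW)
  simp_rw [hint]
  rw [integral_exp_mul_Ioi hneg, mul_zero, Real.exp_zero, neg_div_neg_eq]
  field_simp

end HetNet

/-- With zero noise and self-interference, interfering users modelled as homogeneous PPPs and no
jammer selection, the connection probability of the typical user, as well as its connection
probability conditioned on being served by tier `k`, for every `k`, is given by one and the same
single integral. (`Real.sinc x = sin x / x`, so the normalized `sinc (2 / α)` is
`Real.sinc (π * (2 / α))`.) -/
theorem corollary1 {K : ℕ} [NeZero K] (N : HetNet K) {Ω : Type*} [MeasurableSpace Ω]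
    (μ : Measure Ω) [IsProbabilityMeasure μ]
    (X : NodeClass K → ℕ → Ω → Plane) (h : NodeClass K → ℕ → Ω → ℝ)
    (hN : N.IsRealization X h μ) (θ : ℝ) (hθ : 0 < θ) :
    let p : ℝ := Real.pi * N.Xi * ∫ v in Set.Ioi (0 : ℝ),
      Real.exp (-(2 * Real.pi * v * θ * N.Xi / (N.α - 2) *
          gaussHypergeometric 1 (1 - 2 / N.α) (2 - 2 / N.α) (-θ))) *
        Real.exp (-(Real.pi * v * (θ * N.PU) ^ (2 / N.α) * ∑ t, N.lam t) /
          Real.sinc (Real.pi * (2 / N.α))) *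
        Real.exp (-(Real.pi * v * (θ * N.PJ) ^ (2 / N.α) * N.lamJ) /
          Real.sinc (Real.pi * (2 / N.α))) *
        Real.exp (-(Real.pi * v * N.Xi))
    (μ (N.connected X h ∞ 0 0 θ)).toReal = p ∧
      ∀ k : Fin K, (ProbabilityTheory.cond μ (N.servedBy X k) (N.connected X h ∞ 0 0 θ)).toReal = p := by
  have hX := N.Xi_pos
  have hW := N.decayRate_pos hθ.le
  have hp := N.integral_exp_eq_div_decayRate hθ.le
  intro p
  refine ⟨?_, fun k => ?_⟩
  · rw [hN.measure_connected hθ.le, ENNReal.toReal_ofReal (by positivity)]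
    exact hp.symm
  · rw [hN.cond_connected hθ.le k, ENNReal.toReal_ofReal (by positivity)]
    exact hp.symm
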